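/- All graphs are finite and simple. A graph is \emph{locally irregular} if any two adjacent vertices have distinct degrees. A \emph{locally irregular decomposition} of a graph $G$ of size $k$ is a collection of $k$ locally irregular subgraphs $H_1,\dots,H_k$ of $G$ such that $\{E(H_1),\dots,E(H_k)\}$ is a partition of $E(G)$ into nonempty parts; $\chi'_{\rm irr}(G)$ denotes the smallest size of a locally irregular decomposition of $G$, with $\chi'_{\rm irr}(G)=\infty$ if there is none. \textbf{Theorem.} Let $G$ be a graph whose vertex set is the disjoint union of an inclusion-maximal clique $X=\{v_1,\dots,v_n\}$ with $n$ vertices and a stable set $Y$. Let $d_i$ be the number of neighbours of $v_i$ in $Y$, where the vertices are labelled so that $d_1\ge\cdots\ge d_n$. If $n\ge 10$, then the following hold. \begin{enumerate} \item[(i)] $\chi'_{\rm irr}(G)\le 2$ if and only if $d_1\ge\lfloor n/2\rfloor$ or $d_2\ge 1$. \item[(ii)] $\chi'_{\rm irr}(G)=3$ if and only if $d_1<\lfloor n/2\rfloor$ and $d_2=0$. \end{enumerate} In particular, $\chi'_{\rm irr}(G)\le 3$, that is, $G$ decomposes into at most three locally irregular subgraphs. -/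

import Mathlib

namespace SplitIrr

/-- A graph is locally irregular if adjacent vertices have distinct degrees. -/
def IsLocallyIrregular {V : Type*} (G : SimpleGraph V) [G.LocallyFinite] : Prop :=
  ∀ ⦃u v : V⦄, G.Adj u v → G.degree u ≠ G.degree v

/-- The subgraphs `H 0, …, H (k - 1)` form a decomposition of `G`: their edge sets are the
(nonempty, pairwise disjoint) parts of a partition of the edge set of `G`. -/
structure IsDecomposition {V : Type*} (G : SimpleGraph V) {k : ℕ} (H : Fin k → G.Subgraph) :
    Prop where
  nonempty : ∀ i, (H i).edgeSet.Nonempty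
  disjoint : ∀ i j, i ≠ j → Disjoint (H i).edgeSet (H j).edgeSet
  cover : ⋃ i, (H i).edgeSet = G.edgeSet

open Classical in
/-- `G` has a decomposition into exactly `k` subgraphs, each of which is locally irregular
(as a graph in its own right). -/
def HasIrrDecomposition {V : Type*} [Fintype V] (G : SimpleGraph V) (k : ℕ) : Prop :=
  ∃ H : Fin k → G.Subgraph, IsDecomposition G H ∧ ∀ i, IsLocallyIrregular (H i).coe

/-- The irregular chromatic index: the smallest size of a locally irregular decomposition of `G`,
with value `⊤` if and only if `G` is not decomposable. -/
noncomputable def irrChromaticIndex {V : Type*} [Fintype V] (G : SimpleGraph V) : ℕ∞ :=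
  ⨅ (k : ℕ) (_ : HasIrrDecomposition G k), (k : ℕ∞)

/-- `G` is a split graph `G(X, Y)`: `X` is a maximal clique and its complement `Y` is stable. -/
structure IsSplit {V : Type*} (G : SimpleGraph V) (X Y : Set V) : Prop where
  maximal_clique : Maximal G.IsClique X
  compl : Y = Xᶜ
  stable : G.IsIndepSet Y

/-- The number of neighbours of `v` in `Y`. -/
noncomputable def degIn {V : Type*} (G : SimpleGraph V) (v : V) (Y : Set V) : ℕ :=
  (G.neighborSet v ∩ Y).ncard

end SplitIrr

/-! Upper bound two. Put h = ⌊n/2⌋, number the clique vertices 0, …, n - 1 in a suitable order and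
colour the clique edge ij red if i + j ≥ 2h, blue otherwise. In each colour the clique degrees are
then distinct, except that h - 1 and h tie; their edge is blue. The edges to Y must break this tie
without creating new conflicts, while each vertex of Y keeps a smaller degree than its neighbours.
If more than h clique vertices have neighbours in Y, colour the edges to Y red from the upper half
and blue from the lower half (`irregularUnion_of_many`). Maximality of the clique supplies the one
strict inequality that counting misses. Otherwise vertex h receives the least positive d. If this
value is large, all edges to Y can be blue (`irregularUnion_of_large`). If it is small, h collides
with one lower vertex in blue, and their edge is recoloured along a 5-cycle that changes only the
red degree of n - 1; red edges from n - 1 to Y absorb the change (`irregularUnion_of_two_le`), with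
an extra triangle flip when there is only one such edge (`irregularUnion_of_eq_one`).

Lower bound. If only v₁ has neighbours in Y, the red degrees of the other clique vertices are
distinct, and up to swapping colours they are 1, …, n - 1. Double counting determines which of them
are red neighbours of v₁ (`adj_zero_iff_of_rdeg_injective`), and v₁ then avoids all their degrees
only if d₁ ≥ h.

Upper bound three. Removing a star centred at v₁ turns v₁ into a stable vertex and leaves a split
graph of the first kind. -/

namespace SplitIrr

/-! ### Decompositions as families of locally irregular graphs -/

/-- The degree of `x` in `H`. -/
noncomputable def deg {V : Type*} (H : SimpleGraph V) (x : V) : ℕ := (H.neighborSet x).ncard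

/-- `H` is locally irregular; isolated vertices are irrelevant. -/
def Irregular {V : Type*} (H : SimpleGraph V) : Prop :=
  ∀ ⦃u v : V⦄, H.Adj u v → deg H u ≠ deg H v

/-- `G` is the edge-disjoint union of two locally irregular graphs. -/
def IrregularUnion {V : Type*} (G : SimpleGraph V) : Prop :=
  ∃ R S : SimpleGraph V, (∀ a b, G.Adj a b ↔ R.Adj a b ∨ S.Adj a b) ∧
    (∀ a b, R.Adj a b → ¬ S.Adj a b) ∧ Irregular R ∧ Irregular S

open Classical in
theorem coe_degree_eq_deg {V : Type*} [Fintype V] {G : SimpleGraph V} (H : G.Subgraph)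
    (u : H.verts) : H.coe.degree u = deg H.spanningCoe u := by
  rw [SimpleGraph.Subgraph.coe_degree, SimpleGraph.Subgraph.degree, deg,
    ← Nat.card_eq_fintype_card]
  rfl

open Classical in
theorem isLocallyIrregular_coe_iff {V : Type*} [Fintype V] {G : SimpleGraph V} (H : G.Subgraph) :
    IsLocallyIrregular H.coe ↔ Irregular H.spanningCoe := by
  constructor
  · intro h u v huv
    have hu : u ∈ H.verts := H.edge_vert huv
    have hv : v ∈ H.verts := H.edge_vert huv.symm
    have := @h ⟨u, hu⟩ ⟨v, hv⟩ huv
    rwa [coe_degree_eq_deg, coe_degree_eq_deg] at this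
  · intro h u v huv
    rw [coe_degree_eq_deg, coe_degree_eq_deg]
    exact h huv

open Classical in
theorem irrChromaticIndex_le_of_irregular {V : Type*} [Fintype V] {G : SimpleGraph V} {k : ℕ}
    (C : Fin k → SimpleGraph V)
    (hdisj : ∀ i j, i ≠ j → ∀ a b, (C i).Adj a b → ¬ (C j).Adj a b)
    (hcov : ∀ a b, G.Adj a b ↔ ∃ i, (C i).Adj a b)
    (hirr : ∀ i, Irregular (C i)) : irrChromaticIndex G ≤ k := by
  -- Parts of a decomposition must be nonempty, so the empty classes are dropped; the size can only
  -- decrease.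
  let S : Finset (Fin k) := Finset.univ.filter fun i => C i ≠ ⊥
  have hle : ∀ i, C i ≤ G := fun i a b h => (hcov a b).2 ⟨i, h⟩
  let e := S.equivFin.symm
  have hdec : HasIrrDecomposition G S.card := by
    refine ⟨fun j => SimpleGraph.toSubgraph (C (e j)) (hle _), ⟨?_, ?_, ?_⟩, ?_⟩
    · intro j
      have h1 : C (e j) ≠ ⊥ := (Finset.mem_filter.1 (e j).2).2
      obtain ⟨x, hx⟩ := SimpleGraph.edgeSet_nonempty.2 h1
      refine ⟨x, ?_⟩
      induction x with
      | _ a b => exact hx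
    · intro i j hij
      rw [Set.disjoint_left]
      intro x
      induction x with
      | _ a b =>
        intro h1 h2
        refine hdisj (e i) (e j) ?_ a b h1 h2
        intro h
        exact hij (e.injective (Subtype.ext h))
    · ext x
      induction x with
      | _ a b =>
        simp only [Set.mem_iUnion, SimpleGraph.Subgraph.mem_edgeSet, SimpleGraph.mem_edgeSet]
        rw [hcov]
        constructor
        · rintro ⟨j, h⟩
          exact ⟨e j, h⟩
        · rintro ⟨i, h⟩
          have hi : i ∈ S := by
            refine Finset.mem_filter.2 ⟨Finset.mem_univ _, ?_⟩
            rintro h0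
            rw [h0] at h
            exact h
          refine ⟨e.symm ⟨i, hi⟩, ?_⟩
          simpa using h
    · intro j
      rw [isLocallyIrregular_coe_iff]
      exact hirr (e j)
  have h1 : irrChromaticIndex G ≤ (S.card : ℕ∞) := iInf₂_le S.card hdec
  refine h1.trans ?_
  have := S.card_le_univ
  rw [Fintype.card_fin] at this
  exact_mod_cast this

theorem IrregularUnion.irrChromaticIndex_le_two {V : Type*} [Fintype V] {G : SimpleGraph V}
    (hG : IrregularUnion G) : irrChromaticIndex G ≤ 2 := by
  obtain ⟨R, S, hcov, hdisj, hR, hS⟩ := hG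
  refine irrChromaticIndex_le_of_irregular (k := 2) ![R, S] ?_ ?_ ?_
  · intro i j hij a b
    fin_cases i <;> fin_cases j <;> simp_all
    exact imp_not_comm.1 (hdisj a b)
  · intro a b
    simp [hcov, Fin.exists_fin_two]
  · intro i
    fin_cases i
    · exact hR
    · exact hS

theorem irregularUnion_of_irrChromaticIndex_le_two {V : Type*} [Fintype V] {G : SimpleGraph V}
    (h : irrChromaticIndex G ≤ 2) :
    IrregularUnion G := by
  obtain ⟨k, hk, H, hH, hirr⟩ : ∃ k : ℕ, k ≤ 2 ∧ HasIrrDecomposition G k := by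
    by_contra hcon
    push Not at hcon
    have h3 : (3 : ℕ∞) ≤ irrChromaticIndex G := by
      refine le_iInf₂ fun k hk => ?_
      have : 3 ≤ k := by
        by_contra h'
        exact hcon k (by omega) hk
      exact_mod_cast this
    exact absurd (h3.trans h) (by decide)
  -- The empty graph stands in for the classes missing when `k < 2`.
  have hbot : Irregular (⊥ : SimpleGraph V) := fun u v huv => huv.elim
  have hadj : ∀ a b, G.Adj a b ↔ ∃ i, (H i).Adj a b := by
    intro a b
    rw [← SimpleGraph.mem_edgeSet, ← hH.cover]
    simp
  have hdis : ∀ i j, i ≠ j → ∀ a b, (H i).Adj a b → ¬ (H j).Adj a b := by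
    intro i j hij a b h1 h2
    exact Set.disjoint_left.1 (hH.disjoint i j hij)
      (SimpleGraph.Subgraph.mem_edgeSet.2 h1) (SimpleGraph.Subgraph.mem_edgeSet.2 h2)
  have hir : ∀ i, Irregular (H i).spanningCoe := fun i =>
    (isLocallyIrregular_coe_iff _).1 (hirr i)
  match k, hk with
  | 0, _ =>
    refine ⟨⊥, ⊥, fun a b => ?_, fun a b h => h.elim, hbot, hbot⟩
    rw [hadj]
    simp
  | 1, _ =>
    refine ⟨(H 0).spanningCoe, ⊥, fun a b => ?_, fun a b _ h => h, hir 0, hbot⟩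
    rw [hadj]
    simp
  | 2, _ =>
    refine ⟨(H 0).spanningCoe, (H 1).spanningCoe, fun a b => ?_, fun a b => ?_, hir 0, hir 1⟩
    · rw [hadj, Fin.exists_fin_two]
      simp
    · exact hdis 0 1 (by decide) a b

/-! ### Labelled split graphs and their two-colourings -/

/-- The vertices `w 0, …, w (n - 1)` are distinct, form a clique of `G`, the other vertices form a
stable set, and `w i` has exactly `e i` neighbours in that stable set. -/
structure SplitLabelling {V : Type*} (G : SimpleGraph V) (n : ℕ) (w : ℕ → V) (e : ℕ → ℕ) :
    Prop where
  inj : ∀ i < n, ∀ j < n, w i = w j → i = j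
  clique : ∀ i < n, ∀ j < n, i ≠ j → G.Adj (w i) (w j)
  stable : ∀ a b, (∀ i < n, a ≠ w i) → (∀ i < n, b ≠ w i) → ¬ G.Adj a b
  leaves : ∀ i < n, {y | G.Adj (w i) y ∧ ∀ j < n, y ≠ w j}.ncard = e i

/-- The order of the clique vertices is the main freedom in the colourings: each case permutes the
labels before a fixed pattern is applied. -/
theorem SplitLabelling.comp {V : Type*} {G : SimpleGraph V} {n : ℕ} {w : ℕ → V} {e : ℕ → ℕ}
    (hw : SplitLabelling G n w e) (p : ℕ → ℕ) (hp : ∀ i < n, p i < n)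
    (hinj : ∀ i < n, ∀ j < n, p i = p j → i = j) :
    SplitLabelling G n (w ∘ p) (e ∘ p) := by
  have hmaps : Set.MapsTo p (Finset.range n) (Finset.range n) := by
    intro i hi
    simp only [Finset.coe_range, Set.mem_Iio] at hi ⊢
    exact hp i hi
  have hsurj : ∀ j < n, ∃ i < n, p i = j := by
    intro j hj
    have := Finset.surjOn_of_injOn_of_card_le p hmaps
      (fun a ha b hb => hinj a (by simpa using ha) b (by simpa using hb)) le_rfl
    obtain ⟨i, hi, h⟩ := this (show j ∈ (Finset.range n : Set ℕ) by simpa using hj)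
    exact ⟨i, by simpa using hi, h⟩
  have hout : ∀ a, (∀ i < n, a ≠ (w ∘ p) i) ↔ ∀ i < n, a ≠ w i := by
    intro a
    constructor
    · intro h i hi
      obtain ⟨j, hj, rfl⟩ := hsurj i hi
      exact h j hj
    · intro h i hi
      exact h _ (hp i hi)
  refine ⟨?_, ?_, ?_, ?_⟩
  · intro i hi j hj h
    exact hinj i hi j hj (hw.inj _ (hp i hi) _ (hp j hj) h)
  · intro i hi j hj h
    exact hw.clique _ (hp i hi) _ (hp j hj) fun h' => h (hinj i hi j hj h')
  · intro a b ha hb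
    exact hw.stable a b ((hout a).1 ha) ((hout b).1 hb)
  · intro i hi
    simp_rw [hout]
    exact hw.leaves _ (hp i hi)

open Classical in
/-- The number of `j < n` other than `i` that are related to `i`. -/
noncomputable def rdeg (n : ℕ) (c : ℕ → ℕ → Prop) (i : ℕ) : ℕ :=
  ((Finset.range n).filter fun j => i ≠ j ∧ c i j).card

theorem rdeg_congr {n : ℕ} {c c' : ℕ → ℕ → Prop} {i : ℕ}
    (h : ∀ j < n, j ≠ i → (c' i j ↔ c i j)) : rdeg n c' i = rdeg n c i := by
  classical
  rw [rdeg, rdeg]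
  congr 1
  ext j
  simp only [Finset.mem_filter, Finset.mem_range]
  constructor
  · rintro ⟨hj, hne, hc⟩
    exact ⟨hj, hne, (h j hj hne.symm).1 hc⟩
  · rintro ⟨hj, hne, hc⟩
    exact ⟨hj, hne, (h j hj hne.symm).2 hc⟩

theorem rdeg_add_rdeg_not {n : ℕ} (c : ℕ → ℕ → Prop) {i : ℕ} (hi : i < n) :
    rdeg n c i + rdeg n (fun a b => ¬ c a b) i = n - 1 := by
  classical
  have h1 : ((Finset.range n).erase i).card = n - 1 := by
    rw [Finset.card_erase_of_mem (by simpa using hi), Finset.card_range]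
  rw [← h1, ← Finset.card_filter_add_card_filter_not (s := (Finset.range n).erase i)
    (fun j => c i j), rdeg, rdeg]
  congr 2 <;> ext j <;> simp <;> tauto

open Classical in
/-- The number of neighbours `w j` of `y` with `L j`. -/
noncomputable def leafDeg {V : Type*} (G : SimpleGraph V) (n : ℕ) (w : ℕ → V) (L : ℕ → Prop)
    (y : V) : ℕ :=
  ((Finset.range n).filter fun j => L j ∧ G.Adj (w j) y).card

theorem leafDeg_le {V : Type*} {G : SimpleGraph V} {n : ℕ} {w : ℕ → V} {L : ℕ → Prop} {y : V}
    (S : Finset ℕ) (hS : ∀ j < n, L j → G.Adj (w j) y → j ∈ S) : leafDeg G n w L y ≤ S.card := by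
  classical
  refine Finset.card_le_card fun j hj => ?_
  simp only [Finset.mem_filter, Finset.mem_range] at hj
  exact hS j hj.1 hj.2.1 hj.2.2

/-- One colour class of a split graph: clique edges follow `c`, and the edges from `w i` to the
stable set belong to the class if and only if `L i`. -/
structure ColourClass {V : Type*} (G : SimpleGraph V) (n : ℕ) (w : ℕ → V)
    (c : ℕ → ℕ → Prop) (L : ℕ → Prop) (H : SimpleGraph V) : Prop where
  clique : ∀ i < n, ∀ j < n, H.Adj (w i) (w j) ↔ i ≠ j ∧ c i j
  leaf : ∀ i < n, ∀ y, (∀ j < n, y ≠ w j) → (H.Adj (w i) y ↔ L i ∧ G.Adj (w i) y)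
  stable : ∀ a b, (∀ i < n, a ≠ w i) → (∀ i < n, b ≠ w i) → ¬ H.Adj a b

theorem deg_eq_rdeg_add {V : Type*} [Fintype V] {n : ℕ} {w : ℕ → V}
    (hinj : ∀ i < n, ∀ j < n, w i = w j → i = j) (H : SimpleGraph V) (i : ℕ) :
    deg H (w i) = rdeg n (fun a b => H.Adj (w a) (w b)) i +
      {y | H.Adj (w i) y ∧ ∀ j < n, y ≠ w j}.ncard := by
  classical
  have hsplit : H.neighborSet (w i) =
      w '' ((Finset.range n).filter fun j => i ≠ j ∧ H.Adj (w i) (w j) : Finset ℕ) ∪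
        {y | H.Adj (w i) y ∧ ∀ j < n, y ≠ w j} := by
    ext y
    simp only [SimpleGraph.mem_neighborSet, Set.mem_union, Set.mem_image, Finset.coe_filter,
      Finset.mem_range, Set.mem_ofPred_eq]
    constructor
    · intro h
      by_cases hy : ∀ j < n, y ≠ w j
      · exact Or.inr ⟨h, hy⟩
      · push Not at hy
        obtain ⟨j, hj, rfl⟩ := hy
        exact Or.inl ⟨j, ⟨hj, fun hij => H.loopless.irrefl _ (hij ▸ h), h⟩, rfl⟩
    · rintro (⟨j, ⟨_, _, h⟩, rfl⟩ | ⟨h, _⟩) <;> exact h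
  rw [deg, hsplit, Set.ncard_union_eq ?_ (Set.toFinite _) (Set.toFinite _)]
  · congr 1
    rw [Set.InjOn.ncard_image, Set.ncard_coe_finset, rdeg]
    intro a ha b hb h
    simp only [Finset.coe_filter, Finset.mem_range, Set.mem_ofPred_eq] at ha hb
    exact hinj a ha.1 b hb.1 h
  · rw [Set.disjoint_left]
    rintro y ⟨j, hj, rfl⟩ hy
    simp only [Finset.coe_filter, Finset.mem_range, Set.mem_ofPred_eq] at hj
    exact hy.2 j hj.1 rfl

open Classical in
theorem ColourClass.deg_clique {V : Type*} [Fintype V] {G : SimpleGraph V} {n : ℕ} {w : ℕ → V}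
    {e : ℕ → ℕ} {c : ℕ → ℕ → Prop} {L : ℕ → Prop} {H : SimpleGraph V}
    (hw : SplitLabelling G n w e) (hH : ColourClass G n w c L H) {i : ℕ} (hi : i < n) :
    deg H (w i) = rdeg n c i + if L i then e i else 0 := by
  have hleaf : {y | H.Adj (w i) y ∧ ∀ j < n, y ≠ w j} =
      {y | (L i ∧ G.Adj (w i) y) ∧ ∀ j < n, y ≠ w j} := by
    ext y
    exact and_congr_left fun hy => hH.leaf i hi y hy
  rw [deg_eq_rdeg_add hw.inj, hleaf]
  congr 1
  · refine rdeg_congr fun j hj hij => ?_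
    rw [hH.clique i hi j hj]
    exact and_iff_right hij.symm
  · split_ifs with hL
    · simpa [hL] using hw.leaves i hi
    · simp [hL]

open Classical in
theorem ColourClass.deg_stable {V : Type*} [Fintype V] {G : SimpleGraph V} {n : ℕ} {w : ℕ → V}
    {e : ℕ → ℕ} {c : ℕ → ℕ → Prop} {L : ℕ → Prop} {H : SimpleGraph V}
    (hw : SplitLabelling G n w e) (hH : ColourClass G n w c L H) {y : V}
    (hy : ∀ j < n, y ≠ w j) :
    deg H y = leafDeg G n w L y := by
  have hsplit : H.neighborSet y =
      w '' ((Finset.range n).filter fun j => L j ∧ G.Adj (w j) y : Finset ℕ) := by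
    ext x
    simp only [SimpleGraph.mem_neighborSet, Set.mem_image, Finset.coe_filter,
      Finset.mem_range, Set.mem_ofPred_eq]
    constructor
    · intro h
      by_cases hx : ∀ j < n, x ≠ w j
      · exact (hH.stable y x hy hx h).elim
      · push Not at hx
        obtain ⟨j, hj, rfl⟩ := hx
        exact ⟨j, ⟨hj, (hH.leaf j hj y hy).1 h.symm⟩, rfl⟩
    · rintro ⟨j, ⟨hj, h⟩, rfl⟩
      exact ((hH.leaf j hj y hy).2 h).symm
  rw [deg, hsplit, Set.InjOn.ncard_image, Set.ncard_coe_finset, leafDeg]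
  intro a ha b hb h
  simp only [Finset.coe_filter, Finset.mem_range, Set.mem_ofPred_eq] at ha hb
  exact hw.inj a ha.1 b hb.1 h

-- The strict inequality `hl` settles every edge to the stable set, so only clique edges need a
-- comparison of degrees.
open Classical in
theorem ColourClass.irregular {V : Type*} [Fintype V] {G : SimpleGraph V} {n : ℕ} {w : ℕ → V}
    {e : ℕ → ℕ} {c : ℕ → ℕ → Prop} {L : ℕ → Prop} {H : SimpleGraph V}
    (hw : SplitLabelling G n w e) (hH : ColourClass G n w c L H)
    (hc : ∀ i < n, ∀ j < n, i < j → c i j →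
      rdeg n c i + (if L i then e i else 0) ≠ rdeg n c j + (if L j then e j else 0))
    (hl : ∀ i < n, L i → ∀ y, (∀ j < n, y ≠ w j) → G.Adj (w i) y →
      leafDeg G n w L y < rdeg n c i + e i) :
    Irregular H := by
  have hleaf : ∀ i < n, ∀ y, (∀ j < n, y ≠ w j) → H.Adj (w i) y → deg H y < deg H (w i) := by
    intro i hi y hy h
    obtain ⟨hL, hG⟩ := (hH.leaf i hi y hy).1 h
    rw [hH.deg_stable hw hy, hH.deg_clique hw hi, if_pos hL]
    exact hl i hi hL y hy hG
  intro u v huv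
  by_cases hu : ∀ j < n, u ≠ w j
  · by_cases hv : ∀ j < n, v ≠ w j
    · exact (hH.stable u v hu hv huv).elim
    · push Not at hv
      obtain ⟨j, hj, rfl⟩ := hv
      exact (hleaf j hj u hu huv.symm).ne
  · push Not at hu
    obtain ⟨i, hi, rfl⟩ := hu
    by_cases hv : ∀ j < n, v ≠ w j
    · exact (hleaf i hi v hv huv).ne'
    · push Not at hv
      obtain ⟨j, hj, rfl⟩ := hv
      rw [hH.deg_clique hw hi, hH.deg_clique hw hj]
      rcases lt_trichotomy i j with h | h | h
      · exact hc i hi j hj h ((hH.clique i hi j hj).1 huv).2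
      · exact (((hH.clique i hi j hj).1 huv).1 h).elim
      · exact (hc j hj i hi h ((hH.clique j hj i hi).1 huv.symm).2).symm

/-- The colour class of a split graph determined by `c` and `L`. -/
def colourGraph {V : Type*} (G : SimpleGraph V) (n : ℕ) (w : ℕ → V)
    (c : ℕ → ℕ → Prop) (L : ℕ → Prop) : SimpleGraph V where
  Adj a b := G.Adj a b ∧ ((∃ i < n, ∃ j < n, a = w i ∧ b = w j ∧ c i j ∧ c j i) ∨
    (∃ i < n, a = w i ∧ (∀ j < n, b ≠ w j) ∧ L i) ∨
    (∃ i < n, b = w i ∧ (∀ j < n, a ≠ w j) ∧ L i))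
  symm := ⟨by
    rintro a b ⟨hG, ⟨i, hi, j, hj, ha, hb, h, h'⟩ | h | h⟩
    · exact ⟨hG.symm, Or.inl ⟨j, hj, i, hi, hb, ha, h', h⟩⟩
    · exact ⟨hG.symm, Or.inr (Or.inr h)⟩
    · exact ⟨hG.symm, Or.inr (Or.inl h)⟩⟩
  loopless := ⟨fun a h => G.loopless.irrefl a h.1⟩

theorem colourClass_colourGraph {V : Type*} {G : SimpleGraph V} {n : ℕ} {w : ℕ → V}
    {e : ℕ → ℕ} {c : ℕ → ℕ → Prop} {L : ℕ → Prop} (hw : SplitLabelling G n w e)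
    (hsymm : ∀ i j, c i j → c j i) : ColourClass G n w c L (colourGraph G n w c L) := by
  refine ⟨?_, ?_, ?_⟩
  · intro i hi j hj
    constructor
    · rintro ⟨hG, ⟨i', hi', j', hj', ha, hb, h, -⟩ | ⟨_, _, _, h, _⟩ | ⟨_, _, _, h, _⟩⟩
      · obtain rfl := hw.inj i hi i' hi' ha
        obtain rfl := hw.inj j hj j' hj' hb
        refine ⟨?_, h⟩
        rintro rfl
        exact G.loopless.irrefl _ hG
      · exact (h j hj rfl).elim
      · exact (h i hi rfl).elim
    · rintro ⟨hne, h⟩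
      exact ⟨hw.clique i hi j hj hne, Or.inl ⟨i, hi, j, hj, rfl, rfl, h, hsymm _ _ h⟩⟩
  · intro i hi y hy
    constructor
    · rintro ⟨hG, ⟨_, _, j', hj', _, hb, _⟩ | ⟨i', hi', ha, _, h⟩ | ⟨j', hj', h, _⟩⟩
      · exact (hy j' hj' hb).elim
      · obtain rfl := hw.inj i hi i' hi' ha
        exact ⟨h, hG⟩
      · exact (hy j' hj' h).elim
    · rintro ⟨h, hG⟩
      exact ⟨hG, Or.inr (Or.inl ⟨i, hi, rfl, hy, h⟩)⟩
  · intro a b ha hb h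
    exact hw.stable a b ha hb h.1

open Classical in
/-- A colouring of a split graph by two colours in which every vertex of the stable set has
smaller degree than its neighbours, for each colour, yields two locally irregular graphs. -/
theorem SplitLabelling.exists_irregular {V : Type*} [Fintype V] {G : SimpleGraph V} {n : ℕ}
    {w : ℕ → V} {e : ℕ → ℕ} (hw : SplitLabelling G n w e) (c : ℕ → ℕ → Prop) (L : ℕ → Prop)
    (r : ℕ → ℕ) (hsymm : ∀ i j, c i j → c j i)
    (hr : ∀ i < n, rdeg n c i = r i)
    (hred : ∀ i < n, ∀ j < n, i < j → c i j →
      r i + (if L i then e i else 0) ≠ r j + (if L j then e j else 0))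
    (hblue : ∀ i < n, ∀ j < n, i < j → ¬ c i j →
      (n - 1 - r i) + (if L i then 0 else e i) ≠ (n - 1 - r j) + (if L j then 0 else e j))
    (hlred : ∀ i < n, L i → ∀ y, (∀ j < n, y ≠ w j) → G.Adj (w i) y →
      leafDeg G n w L y < r i + e i)
    (hlblue : ∀ i < n, ¬ L i → ∀ y, (∀ j < n, y ≠ w j) → G.Adj (w i) y →
      leafDeg G n w (fun j => ¬ L j) y < (n - 1 - r i) + e i) :
    IrregularUnion G := by
  have hsymm' : ∀ i j, ¬ c i j → ¬ c j i := fun i j h h' => h (hsymm _ _ h')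
  have hR := colourClass_colourGraph (L := L) hw hsymm
  have hS := colourClass_colourGraph (L := fun i => ¬ L i) hw hsymm'
  have hr' : ∀ i < n, rdeg n (fun a b => ¬ c a b) i = n - 1 - r i := by
    intro i hi
    have := rdeg_add_rdeg_not c hi
    rw [hr i hi] at this
    omega
  refine ⟨_, _, ?_, ?_, hR.irregular hw ?_ ?_, hS.irregular hw ?_ ?_⟩
  · intro a b
    constructor
    · intro hG
      by_cases ha : ∀ j < n, a ≠ w j
      · by_cases hb : ∀ j < n, b ≠ w j
        · exact (hw.stable a b ha hb hG).elim
        · push Not at hb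
          obtain ⟨j, hj, rfl⟩ := hb
          by_cases hL : L j
          · exact Or.inl ((hR.leaf j hj a ha).2 ⟨hL, hG.symm⟩).symm
          · exact Or.inr ((hS.leaf j hj a ha).2 ⟨hL, hG.symm⟩).symm
      · push Not at ha
        obtain ⟨i, hi, rfl⟩ := ha
        by_cases hb : ∀ j < n, b ≠ w j
        · by_cases hL : L i
          · exact Or.inl ((hR.leaf i hi b hb).2 ⟨hL, hG⟩)
          · exact Or.inr ((hS.leaf i hi b hb).2 ⟨hL, hG⟩)
        · push Not at hb
          obtain ⟨j, hj, rfl⟩ := hb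
          have hne : i ≠ j := by
            rintro rfl
            exact G.loopless.irrefl _ hG
          by_cases hc : c i j
          · exact Or.inl ((hR.clique i hi j hj).2 ⟨hne, hc⟩)
          · exact Or.inr ((hS.clique i hi j hj).2 ⟨hne, hc⟩)
    · rintro (h | h)
      · exact h.1
      · exact h.1
  · intro a b h1 h2
    have hG := h1.1
    by_cases ha : ∀ j < n, a ≠ w j
    · by_cases hb : ∀ j < n, b ≠ w j
      · exact hw.stable a b ha hb hG
      · push Not at hb
        obtain ⟨j, hj, rfl⟩ := hb
        exact ((hS.leaf j hj a ha).1 h2.symm).1 ((hR.leaf j hj a ha).1 h1.symm).1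
    · push Not at ha
      obtain ⟨i, hi, rfl⟩ := ha
      by_cases hb : ∀ j < n, b ≠ w j
      · exact ((hS.leaf i hi b hb).1 h2).1 ((hR.leaf i hi b hb).1 h1).1
      · push Not at hb
        obtain ⟨j, hj, rfl⟩ := hb
        exact ((hS.clique i hi j hj).1 h2).2 ((hR.clique i hi j hj).1 h1).2
  · intro i hi j hj hij h
    rw [hr i hi, hr j hj]
    exact hred i hi j hj hij h
  · intro i hi hL y hy h
    rw [hr i hi]
    exact hlred i hi hL y hy h
  · intro i hi j hj hij h
    rw [hr' i hi, hr' j hj]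
    have := hblue i hi j hj hij h
    by_cases h1 : L i <;> by_cases h2 : L j <;> simp_all
  · intro i hi hL y hy h
    rw [hr' i hi]
    exact hlblue i hi hL y hy h

theorem SplitLabelling.pos_of_adj {V : Type*} [Fintype V] {G : SimpleGraph V} {n : ℕ}
    {w : ℕ → V} {e : ℕ → ℕ} (hw : SplitLabelling G n w e) {i : ℕ} (hi : i < n) {y : V}
    (hy : ∀ j < n, y ≠ w j) (h : G.Adj (w i) y) : 0 < e i := by
  rw [← hw.leaves i hi, Set.ncard_pos (Set.toFinite _)]
  exact ⟨y, h, hy⟩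

theorem SplitLabelling.eq_of_adj {V : Type*} [Fintype V] {G : SimpleGraph V} {n : ℕ}
    {w : ℕ → V} {e : ℕ → ℕ} (hw : SplitLabelling G n w e) {i : ℕ} (hi : i < n) {y z : V}
    (hy : ∀ j < n, y ≠ w j) (h : G.Adj (w i) y) (hz : ∀ j < n, z ≠ w j) (h' : G.Adj (w i) z)
    (he : e i = 1) : y = z := by
  have := hw.leaves i hi
  rw [he, Set.ncard_eq_one] at this
  obtain ⟨a, ha⟩ := this
  have h1 : y ∈ ({a} : Set V) := ha ▸ ⟨h, hy⟩
  have h2 : z ∈ ({a} : Set V) := ha ▸ ⟨h', hz⟩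
  rw [Set.mem_singleton_iff] at h1 h2
  rw [h1, h2]

/-! ### Degrees in the threshold colouring and its modifications -/

/-- The neighbours of `i` form the interval from `2 * h - i` to `n - 1`, which contains `i` itself
once `h ≤ i`. Hence degrees increase strictly with `i`, except for the tie between `h - 1` and `h`,
which are not related. -/
theorem rdeg_threshold {n h i : ℕ} (hn : 2 * h ≤ n) (hn' : n ≤ 2 * h + 1) (hi : i < n) :
    rdeg n (fun i j => 2 * h ≤ i + j) i = i + (n - 2 * h) - if h ≤ i then 1 else 0 := by
  classical
  have : ((Finset.range n).filter fun j => i ≠ j ∧ (fun i j => 2 * h ≤ i + j) i j) =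
      (Finset.Ico (2 * h - i) n).erase i := by
    ext j
    simp only [Finset.mem_filter, Finset.mem_range, Finset.mem_erase, Finset.mem_Ico]
    omega
  rw [rdeg]
  convert_to ((Finset.Ico (2 * h - i) n).erase i).card = _
  · congr 1
    convert this
  rw [Finset.card_erase_eq_ite, Nat.card_Ico]
  simp only [Finset.mem_Ico]
  split_ifs <;> omega

theorem rdeg_swap {n : ℕ} {c c' : ℕ → ℕ → Prop} {i a b : ℕ} (ha : a < n) (hb : b < n)
    (hia : i ≠ a) (hib : i ≠ b) (hca : c i a) (hcb : ¬ c i b)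
    (h : ∀ j < n, j ≠ i → (c' i j ↔ j = b ∨ (c i j ∧ j ≠ a))) : rdeg n c' i = rdeg n c i := by
  classical
  have : ((Finset.range n).filter fun j => i ≠ j ∧ c' i j) =
      insert b (((Finset.range n).filter fun j => i ≠ j ∧ c i j).erase a) := by
    ext j
    simp only [Finset.mem_filter, Finset.mem_range, Finset.mem_erase, Finset.mem_insert]
    constructor
    · rintro ⟨hj, hne, hc⟩
      rcases (h j hj hne.symm).1 hc with h1 | h1
      · exact Or.inl h1
      · exact Or.inr ⟨h1.2, hj, hne, h1.1⟩
    · rintro (rfl | ⟨h1, hj, hne, h2⟩)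
      · exact ⟨hb, hib, (h j hb hib.symm).2 (Or.inl rfl)⟩
      · exact ⟨hj, hne, (h j hj hne.symm).2 (Or.inr ⟨h2, h1⟩)⟩
  rw [rdeg, this, Finset.card_insert_of_notMem (by simp [hcb]), Finset.card_erase_add_one, rdeg]
  simp [ha, hia, hca]

theorem rdeg_remove_pair {n : ℕ} {c c' : ℕ → ℕ → Prop} {i a b : ℕ} (ha : a < n) (hb : b < n)
    (hab : a ≠ b) (hia : i ≠ a) (hib : i ≠ b) (hca : c i a) (hcb : c i b)
    (h : ∀ j < n, j ≠ i → (c' i j ↔ c i j ∧ j ≠ a ∧ j ≠ b)) :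
    rdeg n c' i = rdeg n c i - 2 := by
  classical
  have : ((Finset.range n).filter fun j => i ≠ j ∧ c' i j) =
      (((Finset.range n).filter fun j => i ≠ j ∧ c i j).erase a).erase b := by
    ext j
    simp only [Finset.mem_filter, Finset.mem_range, Finset.mem_erase]
    constructor
    · rintro ⟨hj, hne, hc⟩
      have h1 := (h j hj hne.symm).1 hc
      exact ⟨h1.2.2, h1.2.1, hj, hne, h1.1⟩
    · rintro ⟨h1, h2, hj, hne, h3⟩
      exact ⟨hj, hne, (h j hj hne.symm).2 ⟨h3, h2, h1⟩⟩
  rw [rdeg, this, Finset.card_erase_of_mem, Finset.card_erase_of_mem, rdeg]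
  · rfl
  · simp [ha, hia, hca]
  · simp [hb, hib, hcb, hab.symm]

/-- The two vertices `i` and `j` are `a` and `b` in some order. -/
def IsPair (a b i j : ℕ) : Prop := (i = a ∧ j = b) ∨ (i = b ∧ j = a)

theorem isPair_comm (a b i j : ℕ) : IsPair a b i j ↔ IsPair a b j i := by
  simp only [IsPair]
  tauto

/-- The threshold relation `2 * h ≤ i + j` with the edges of the `5`-cycle
`h, b, n - 1, a, n - 4` flipped. -/
def cycleFlip (n h a b i j : ℕ) : Prop :=
  (2 * h ≤ i + j ∧ ¬ IsPair b (n - 1) i j ∧ ¬ IsPair (n - 1) a i j ∧ ¬ IsPair (n - 4) h i j) ∨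
    IsPair h b i j ∨ IsPair a (n - 4) i j

/-- The relation `cycleFlip n h 1 (h - 2)` with the edges of the triangle `2, n - 1, n - 4`
flipped. -/
def triangleFlip (n h i j : ℕ) : Prop :=
  (cycleFlip n h 1 (h - 2) i j ∧ ¬ IsPair 2 (n - 1) i j ∧ ¬ IsPair (n - 4) (n - 1) i j) ∨
    IsPair 2 (n - 4) i j

theorem cycleFlip_symm {n h a b : ℕ} (i j : ℕ) (H : cycleFlip n h a b i j) :
    cycleFlip n h a b j i := by
  simpa only [cycleFlip, isPair_comm _ _ i j, add_comm i j] using H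

theorem triangleFlip_symm {n h : ℕ} (i j : ℕ) (H : triangleFlip n h i j) :
    triangleFlip n h j i := by
  simp only [triangleFlip, isPair_comm _ _ i j] at H ⊢
  exact H.imp_left fun H => ⟨cycleFlip_symm _ _ H.1, H.2⟩

/-- Around the cycle each vertex gains one edge and loses one, except `n - 1`, which loses two. The
bounds give the flipped edges the right original colours: `1 ≤ a` and `1 ≤ b` make the edges to `n -
1` red, `a ≤ 2` makes the edge from `a` to `n - 4` blue, and `10 ≤ n` puts `n - 4` above `h`. -/
theorem rdeg_cycleFlip {n h a b i : ℕ} (h10 : 10 ≤ n) (hn : 2 * h ≤ n) (hn' : n ≤ 2 * h + 1)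
    (ha : 1 ≤ a) (ha' : a ≤ 2) (hb : 1 ≤ b) (hb' : b + 2 ≤ h) (hab : a ≠ b) (hi : i < n) :
    rdeg n (cycleFlip n h a b) i =
      i + (n - 2 * h) - (if h ≤ i then 1 else 0) - if i = n - 1 then 2 else 0 := by
  rw [← rdeg_threshold hn hn' hi]
  split_ifs with h1
  · subst h1
    refine rdeg_remove_pair (a := a) (b := b) ?_ ?_ ?_ ?_ ?_ ?_ ?_ ?_
    all_goals try omega
    intro j hj hij
    simp only [cycleFlip, IsPair]
    grind
  · rw [Nat.sub_zero]
    rcases eq_or_ne i h with rfl | h2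
    · refine rdeg_swap (a := n - 4) (b := b) ?_ ?_ ?_ ?_ ?_ ?_ ?_
      all_goals try omega
      intro j hj hij
      simp only [cycleFlip, IsPair]
      grind
    rcases eq_or_ne i b with rfl | h3
    · refine rdeg_swap (a := n - 1) (b := h) ?_ ?_ ?_ ?_ ?_ ?_ ?_
      all_goals try omega
      intro j hj hij
      simp only [cycleFlip, IsPair]
      grind
    rcases eq_or_ne i a with rfl | h4
    · refine rdeg_swap (a := n - 1) (b := n - 4) ?_ ?_ ?_ ?_ ?_ ?_ ?_
      all_goals try omega
      intro j hj hij
      simp only [cycleFlip, IsPair]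
      grind
    rcases eq_or_ne i (n - 4) with rfl | h5
    · refine rdeg_swap (a := h) (b := a) ?_ ?_ ?_ ?_ ?_ ?_ ?_
      all_goals try omega
      intro j hj hij
      simp only [cycleFlip, IsPair]
      grind
    refine rdeg_congr fun j hj hij => ?_
    simp only [cycleFlip, IsPair]
    grind

/-- In the triangle, `2` and `n - 4` exchange their red edges to `n - 1` for the edge between them,
so only `n - 1` loses, two more. -/
theorem rdeg_triangleFlip {n h i : ℕ} (h10 : 10 ≤ n) (hn : 2 * h ≤ n) (hn' : n ≤ 2 * h + 1)
    (hi : i < n) :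
    rdeg n (triangleFlip n h) i =
      i + (n - 2 * h) - (if h ≤ i then 1 else 0) - if i = n - 1 then 4 else 0 := by
  have key : rdeg n (triangleFlip n h) i =
      rdeg n (cycleFlip n h 1 (h - 2)) i - if i = n - 1 then 2 else 0 := by
    split_ifs with h1
    · subst h1
      refine rdeg_remove_pair (a := 2) (b := n - 4) ?_ ?_ ?_ ?_ ?_ ?_ ?_ ?_
      all_goals try omega
      · simp only [cycleFlip, IsPair]
        grind
      · simp only [cycleFlip, IsPair]
        grind
      intro j hj hij
      simp only [triangleFlip, cycleFlip, IsPair]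
      grind
    · rw [Nat.sub_zero]
      rcases eq_or_ne i 2 with rfl | h2
      · refine rdeg_swap (a := n - 1) (b := n - 4) ?_ ?_ ?_ ?_ ?_ ?_ ?_
        all_goals try omega
        · simp only [cycleFlip, IsPair]
          grind
        · simp only [cycleFlip, IsPair]
          grind
        intro j hj hij
        simp only [triangleFlip, IsPair]
        grind
      rcases eq_or_ne i (n - 4) with rfl | h5
      · refine rdeg_swap (a := n - 1) (b := 2) ?_ ?_ ?_ ?_ ?_ ?_ ?_
        all_goals try omega
        · simp only [cycleFlip, IsPair]
          grind
        · simp only [cycleFlip, IsPair]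
          grind
        intro j hj hij
        simp only [triangleFlip, IsPair]
        grind
      refine rdeg_congr fun j hj hij => ?_
      simp only [triangleFlip, IsPair]
      grind
  rw [key, rdeg_cycleFlip h10 hn hn' (by omega) (by omega) (by omega) (by omega) (by omega) hi]
  split_ifs <;> omega

/-! ### Colouring patterns for suitable labellings -/

/-- Threshold colouring in which all edges to the stable set are blue. -/
theorem SplitLabelling.irregularUnion_of_large {V : Type*} [Fintype V] {G : SimpleGraph V}
    {n h s : ℕ} {w : ℕ → V} {e : ℕ → ℕ} (hw : SplitLabelling G n w e)
    (hn : 2 * h ≤ n) (hn' : n ≤ 2 * h + 1) (hs : s < h)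
    (hanti : ∀ i j, i < j → j < h → e j ≤ e i)
    (hzero : ∀ i < n, s ≤ i → i ≠ h → e i = 0)
    (hne : ∀ i < h, 2 * h - 1 - i + e i ≠ h + e h) : IrregularUnion G := by
  classical
  refine hw.exists_irregular (fun i j => 2 * h ≤ i + j) (fun _ => False)
    (fun i => i + (n - 2 * h) - if h ≤ i then 1 else 0) (fun i j => by omega)
    (fun i hi => rdeg_threshold hn hn' hi) ?_ ?_ ?_ ?_
  · intro i hi j hj hij hc
    simp only [if_false]
    split_ifs <;> omega
  · intro i hi j hj hij hc
    have h1 := hanti i j hij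
    have h2 := hne i
    have h3 := hzero j hj
    have h4 := hzero i hi
    simp only [if_false]
    rcases lt_trichotomy j h with hjh | rfl | hjh
    · have := h1 hjh
      split_ifs <;> omega
    · have := h2 hij
      split_ifs <;> omega
    · have := h3 (by omega) (by omega)
      split_ifs <;> omega
  · intro i hi hL
    exact hL.elim
  · intro i hi _ y hy hadj
    have hpos := hw.pos_of_adj hi hy hadj
    have h4 := hzero i hi
    -- A stable vertex has at most `s + 1 ≤ h` neighbours, while its neighbours have more than `h`
    -- blue edges.
    refine (leafDeg_le (insert h (Finset.range s)) ?_).trans_lt ?_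
    · intro j hj _ hadj
      have := hw.pos_of_adj hj hy hadj
      have := hzero j hj
      simp only [Finset.mem_insert, Finset.mem_range]
      omega
    · refine (Finset.card_insert_le _ _).trans_lt ?_
      rw [Finset.card_range]
      split_ifs <;> omega

/-- Colouring by `cycleFlip`, where only the vertex `n - 1` has red edges to the stable set. -/
theorem SplitLabelling.irregularUnion_of_two_le {V : Type*} [Fintype V] {G : SimpleGraph V}
    {n h s : ℕ} {w : ℕ → V} {e : ℕ → ℕ} (hw : SplitLabelling G n w e) (h10 : 10 ≤ n)
    (hn : 2 * h ≤ n) (hn' : n ≤ 2 * h + 1) (hs : s + 2 ≤ h)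
    (hanti : ∀ i j, i < j → j < h → e j ≤ e i)
    (hzero : ∀ i < n, s ≤ i → i ≠ h → i ≠ n - 1 → e i = 0)
    (hpos : 1 ≤ e h) (hle : e h + 2 ≤ h) (hmin : ∀ i < s, e h ≤ e i) (htwo : 2 ≤ e (n - 1)) :
    IrregularUnion G := by
  classical
  obtain ⟨a, ha1, ha2, ha⟩ : ∃ a, 1 ≤ a ∧ a ≤ 2 ∧ a ≠ h - 1 - e h := by
    by_cases h1 : 1 = h - 1 - e h
    · exact ⟨2, by omega, by omega, by omega⟩
    · exact ⟨1, by omega, by omega, h1⟩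
  refine hw.exists_irregular (cycleFlip n h a (h - 1 - e h)) (fun i => i = n - 1)
    (fun i => i + (n - 2 * h) - (if h ≤ i then 1 else 0) - if i = n - 1 then 2 else 0)
    cycleFlip_symm
    (fun i hi => rdeg_cycleFlip h10 hn hn' ha1 ha2 (by omega) (by omega) ha hi) ?_ ?_ ?_ ?_
  -- The two red edges lost by `n - 1` are made up by its at least two red edges to the stable set,
  -- so it keeps the largest red degree in the clique.
  · intro i hi j hj hij hc
    have h4 := hzero i hi
    have h5 := hzero j hj
    simp only [cycleFlip, IsPair] at hc
    grind
  · intro i hi j hj hij hc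
    have h1 := hanti i j hij
    have h2 := hmin i
    have h3 := hmin j
    have h4 := hzero i hi
    have h5 := hzero j hj
    simp only [cycleFlip, IsPair] at hc
    grind
  · intro i hi hL y hy hadj
    refine (leafDeg_le {n - 1} ?_).trans_lt ?_
    · intro j hj h1 _
      simpa using h1
    · rw [Finset.card_singleton]
      split_ifs <;> omega
  · intro i hi hL y hy hadj
    have hpos := hw.pos_of_adj hi hy hadj
    have h4 := hzero i hi
    refine (leafDeg_le (insert h (Finset.range s)) ?_).trans_lt ?_
    · intro j hj h1 hadj
      have := hw.pos_of_adj hj hy hadj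
      have := hzero j hj
      simp only [Finset.mem_insert, Finset.mem_range]
      omega
    · refine (Finset.card_insert_le _ _).trans_lt ?_
      rw [Finset.card_range]
      split_ifs <;> omega

/-- Colouring by `triangleFlip`, where only the vertex `n - 1` has a red edge to the stable
set. -/
theorem SplitLabelling.irregularUnion_of_eq_one {V : Type*} [Fintype V] {G : SimpleGraph V}
    {n h s : ℕ} {w : ℕ → V} {e : ℕ → ℕ} (hw : SplitLabelling G n w e) (h10 : 10 ≤ n)
    (hn : 2 * h ≤ n) (hn' : n ≤ 2 * h + 1) (hs : s + 2 ≤ h)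
    (hanti : ∀ i j, i < j → j < h → e j ≤ e i)
    (hzero : ∀ i < n, s ≤ i → i ≠ h → i ≠ n - 1 → e i = 0)
    (hone : e h = 1) (hmin : ∀ i < s, e i = 1) (hone' : e (n - 1) = 1) :
    IrregularUnion G := by
  classical
  -- With a single red edge to the stable set, the cycle flip alone would give `n - 1` the red
  -- degree of its red neighbour `n - 2`. After the triangle flip it has the red degree of `n - 4`,
  -- and the edge between these two is now blue.
  refine hw.exists_irregular (triangleFlip n h) (fun i => i = n - 1)
    (fun i => i + (n - 2 * h) - (if h ≤ i then 1 else 0) - if i = n - 1 then 4 else 0)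
    triangleFlip_symm (fun i hi => rdeg_triangleFlip h10 hn hn' hi) ?_ ?_ ?_ ?_
  · intro i hi j hj hij hc
    have h4 := hzero i hi
    have h5 := hzero j hj
    simp only [triangleFlip, cycleFlip, IsPair] at hc
    grind
  · intro i hi j hj hij hc
    have h1 := hanti i j hij
    have h2 := hmin i
    have h3 := hmin j
    have h4 := hzero i hi
    have h5 := hzero j hj
    simp only [triangleFlip, cycleFlip, IsPair] at hc
    grind
  · intro i hi hL y hy hadj
    refine (leafDeg_le {n - 1} ?_).trans_lt ?_
    · intro j hj h1 _
      simpa using h1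
    · rw [Finset.card_singleton]
      split_ifs <;> omega
  · intro i hi hL y hy hadj
    have hpos := hw.pos_of_adj hi hy hadj
    have h4 := hzero i hi
    refine (leafDeg_le (insert h (Finset.range s)) ?_).trans_lt ?_
    · intro j hj h1 hadj
      have := hw.pos_of_adj hj hy hadj
      have := hzero j hj
      simp only [Finset.mem_insert, Finset.mem_range]
      omega
    · refine (Finset.card_insert_le _ _).trans_lt ?_
      rw [Finset.card_range]
      split_ifs <;> omega

/-- Threshold colouring in which the edges to the stable set are red at `w i` with `h ≤ i` and
blue at the others. -/
theorem SplitLabelling.irregularUnion_of_many {V : Type*} [Fintype V] {G : SimpleGraph V}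
    {n h : ℕ} {w : ℕ → V} {e : ℕ → ℕ} (hw : SplitLabelling G n w e)
    (hn : 2 * h ≤ n) (hn' : n ≤ 2 * h + 1) (hh : 1 ≤ h)
    (hanti : ∀ i j, i < j → j < h → e j ≤ e i)
    (hmono : ∀ i j, h ≤ i → i < j → j < n → e i ≤ e j)
    (hpos : ∀ i < h, 1 ≤ e i)
    (hmax : ∀ y, (∀ j < n, y ≠ w j) → G.Adj (w h) y → e h = 1 →
      ∃ j, h < j ∧ j < n ∧ ¬ G.Adj (w j) y) : IrregularUnion G := by
  classical
  refine hw.exists_irregular (fun i j => 2 * h ≤ i + j) (fun i => h ≤ i)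
    (fun i => i + (n - 2 * h) - if h ≤ i then 1 else 0) (fun i j => by omega)
    (fun i hi => rdeg_threshold hn hn' hi) ?_ ?_ ?_ ?_
  · intro i hi j hj hij hc
    have h1 := hmono i j
    split_ifs <;> omega
  · intro i hi j hj hij hc
    have h1 := hanti i j hij
    have h2 := hpos i
    split_ifs <;> omega
  · intro i hi hL y hy hadj
    have hei := hw.pos_of_adj hi hy hadj
    have hle : leafDeg G n w (fun i => h ≤ i) y ≤ n - h := by
      rw [← Nat.card_Ico]
      refine leafDeg_le _ fun j hj h1 _ => ?_
      simp only [Finset.mem_Ico]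
      exact ⟨h1, hj⟩
    rw [if_pos hL]
    -- At `h` the red degree is `n - h - 1 + e h`, while a stable vertex may have `n - h` red edges.
    -- Only `e h = 1` is critical, and there `hmax` provides a missing edge.
    rcases hL.eq_or_lt with rfl | hlt
    · rcases Nat.eq_or_lt_of_le hei with he | he
      · obtain ⟨q, hq1, hq2, hq⟩ := hmax y hy hadj he.symm
        have : leafDeg G n w (fun i => h ≤ i) y ≤ n - h - 1 := by
          have hc : ((Finset.Ico h n).erase q).card = n - h - 1 := by
            rw [Finset.card_erase_of_mem (by simp; omega), Nat.card_Ico]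
          rw [← hc]
          refine leafDeg_le _ fun j hj h1 hadj' => ?_
          simp only [Finset.mem_Ico, Finset.mem_erase]
          refine ⟨?_, h1, hj⟩
          rintro rfl
          exact hq hadj'
        omega
      · omega
    · omega
  · intro i hi hL y hy hadj
    have hei := hw.pos_of_adj hi hy hadj
    refine (leafDeg_le (Finset.range h) ?_).trans_lt ?_
    · intro j hj h1 _
      simpa using h1
    · rw [Finset.card_range, if_neg hL]
      omega

/-! ### Choice of the labelling: at most two graphs -/

theorem SplitLabelling.irregularUnion_of_pos_mid_of_le {V : Type*} [Fintype V]
    {G : SimpleGraph V} {n h q : ℕ} {w : ℕ → V} {d : ℕ → ℕ} (hw : SplitLabelling G n w d)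
    (hn : 2 * h ≤ n) (hn' : n ≤ 2 * h + 1) (hh : 2 ≤ h)
    (hanti : ∀ i j, i ≤ j → j < n → d j ≤ d i) (hpos : 1 ≤ d h) (hqh : q ≤ h)
    (hmax : ∀ y, (∀ j < n, y ≠ w j) → G.Adj (w (n - 1)) y → d (n - 1) = 1 →
      ∃ j, (j = q ∨ h < j) ∧ j < n ∧ ¬ G.Adj (w j) y) : IrregularUnion G := by
  -- The lower half receives `0, …, h` without `q`, in order; from position `h` on come `n - 1, n -
  -- 2, …, h + 1` and finally `q`. Thus `d` increases on the upper half, which contains `q`.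
  have hp : ∃ p : ℕ → ℕ, p = fun i =>
      if i < q then i else if i < h then i + 1 else if i = n - 1 then q else n - 1 + h - i :=
    ⟨_, rfl⟩
  obtain ⟨p, hp⟩ := hp
  have hlow : ∀ i < h, p i ≤ h := by
    intro i hi
    simp only [hp]
    split_ifs <;> omega
  have hmid : p h = n - 1 := by
    simp only [hp]
    split_ifs <;> omega
  have hlt : ∀ i < n, p i < n := by
    intro i hi
    simp only [hp]
    split_ifs <;> omega
  have hw' := hw.comp p hlt (by
    intro i hi j hj hij
    simp only [hp] at hij
    split_ifs at hij <;> omega)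
  refine hw'.irregularUnion_of_many hn hn' (by omega) ?_ ?_ ?_ ?_
  · intro i j hij hj
    refine hanti _ _ ?_ (hlt j (by omega))
    simp only [hp]
    split_ifs <;> omega
  · intro i j hi hij hj
    refine hanti _ _ ?_ (hlt i (by omega))
    simp only [hp]
    split_ifs <;> omega
  · intro i hi
    exact hpos.trans (hanti _ _ (hlow i hi) (by omega))
  · intro y hy hadj h1
    simp only [Function.comp_apply, hmid] at hadj h1
    have hsurj : ∀ j < n, (j = q ∨ h < j) → j ≠ n - 1 → ∃ i, h < i ∧ i < n ∧ p i = j := by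
      intro j hj hjq hjn
      by_cases hjq' : j = q
      · refine ⟨n - 1, by omega, by omega, ?_⟩
        simp only [hp]
        split_ifs <;> omega
      · refine ⟨n - 1 + h - j, by omega, by omega, ?_⟩
        simp only [hp]
        split_ifs <;> omega
    have hy' : ∀ j < n, y ≠ w j := by
      intro j hj hyj
      subst hyj
      have hnj : n - 1 ≠ j := by
        rintro rfl
        exact G.loopless.irrefl _ hadj
      by_cases hjq : j = q ∨ h < j
      · obtain ⟨i, _, hi, rfl⟩ := hsurj j hj hjq hnj.symm
        exact hy i hi rfl
      · by_cases hlt : j < q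
        · refine hy j hj ?_
          simp [hp, hlt]
        · refine hy (j - 1) (by omega) ?_
          have : p (j - 1) = j := by
            simp only [hp]
            split_ifs <;> omega
          simp [this]
    obtain ⟨j, hj, hjn, hnadj⟩ := hmax y hy' hadj h1
    have hjn' : j ≠ n - 1 := by
      rintro rfl
      exact hnadj hadj
    obtain ⟨i, hi, hi', rfl⟩ := hsurj j hjn hj hjn'
    exact ⟨i, hi, hi', hnadj⟩

/-- The case where more than half of the clique vertices have neighbours in the stable set. -/
theorem SplitLabelling.irregularUnion_of_pos_mid {V : Type*} [Fintype V]
    {G : SimpleGraph V} {n h : ℕ} {w : ℕ → V} {d : ℕ → ℕ} (hw : SplitLabelling G n w d)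
    (hn : 2 * h ≤ n) (hn' : n ≤ 2 * h + 1) (hh : 2 ≤ h)
    (hanti : ∀ i j, i ≤ j → j < n → d j ≤ d i) (hpos : 1 ≤ d h)
    (hmax : d (n - 1) = 1 → ∀ y, (∀ j < n, y ≠ w j) → ∃ j < n, ¬ G.Adj (w j) y) :
    IrregularUnion G := by
  by_cases h1 : d (n - 1) = 1 ∧ ∃ y, (∀ j < n, y ≠ w j) ∧ G.Adj (w (n - 1)) y
  · obtain ⟨h1, y, hy, hadj⟩ := h1
    obtain ⟨j, hj, hnadj⟩ := hmax h1 y hy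
    -- A non-neighbour `j ≤ h` is moved to the upper half as `q = j`; one above `h` is already
    -- there, and `q = h` serves.
    refine hw.irregularUnion_of_pos_mid_of_le hn hn' hh hanti hpos (min_le_right j h) ?_
    intro z hz hz' _
    obtain rfl := hw.eq_of_adj (by omega) hy hadj hz hz' h1
    exact ⟨j, by omega, hj, hnadj⟩
  · refine hw.irregularUnion_of_pos_mid_of_le hn hn' hh hanti hpos le_rfl ?_
    intro y hy hadj h2
    exact (h1 ⟨h2, y, hy, hadj⟩).elim

theorem SplitLabelling.irregularUnion_of_few_large {V : Type*} [Fintype V] {G : SimpleGraph V}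
    {n h k : ℕ} {w : ℕ → V} {d : ℕ → ℕ} (hw : SplitLabelling G n w d)
    (hn : 2 * h ≤ n) (hn' : n ≤ 2 * h + 1)
    (hanti : ∀ i j, i ≤ j → j < n → d j ≤ d i) (hk1 : 1 ≤ k) (hkh : k ≤ h)
    (hzero : ∀ i < n, k ≤ i → d i = 0)
    (hlarge : h ≤ d (k - 1) ∨ (2 ≤ k ∧ h ≤ d (k - 1) + 1)) : IrregularUnion G := by
  -- The least positive value `d (k - 1)` moves to position `h`; the larger ones stay in front.
  obtain ⟨p, hp⟩ : ∃ p : ℕ → ℕ, p = fun i =>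
      if i < k - 1 then i else if i < h then i + 1 else if i = h then k - 1 else i := ⟨_, rfl⟩
  have hlt : ∀ i < n, p i < n := by
    intro i hi
    simp only [hp]
    split_ifs <;> omega
  have hw' := hw.comp p hlt (by
    intro i hi j hj hij
    simp only [hp] at hij
    split_ifs at hij <;> omega)
  have hmid : p h = k - 1 := by
    simp only [hp]
    split_ifs <;> omega
  have hz : ∀ i < n, k - 1 ≤ i → i ≠ h → d (p i) = 0 := by
    intro i hi hki hih
    refine hzero _ (hlt i hi) ?_
    simp only [hp]
    split_ifs <;> omega
  refine hw'.irregularUnion_of_large (s := k - 1) hn hn' (by omega) ?_ hz ?_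
  · intro i j hij hj
    refine hanti _ _ ?_ (hlt j (by omega))
    simp only [hp]
    split_ifs <;> omega
  · intro i hi
    simp only [Function.comp_apply, hmid]
    -- The blue degree `h + d (k - 1)` exceeds that of every lower vertex without stable neighbours
    -- and is below that of every lower vertex with some.
    by_cases hik : k - 1 ≤ i
    · have := hz i (by omega) hik (by omega)
      omega
    · have h1 : p i = i := by
        simp only [hp]
        split_ifs <;> omega
      have := hanti i (k - 1) (by omega) (by omega)
      rw [h1]
      omega

theorem SplitLabelling.irregularUnion_of_few_small {V : Type*} [Fintype V] {G : SimpleGraph V}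
    {n h k : ℕ} {w : ℕ → V} {d : ℕ → ℕ} (hw : SplitLabelling G n w d) (h10 : 10 ≤ n)
    (hn : 2 * h ≤ n) (hn' : n ≤ 2 * h + 1)
    (hanti : ∀ i j, i ≤ j → j < n → d j ≤ d i) (hk2 : 2 ≤ k) (hkh : k ≤ h)
    (hzero : ∀ i < n, k ≤ i → d i = 0) (hpos : 1 ≤ d (k - 1)) (hsmall : d (k - 1) + 2 ≤ h) :
    IrregularUnion G := by
  -- The largest value goes to `n - 1`, the least positive one to `h`, and the other positive ones
  -- to the front.
  obtain ⟨p, hp⟩ : ∃ p : ℕ → ℕ, p = fun i => if i = n - 1 then 0 else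
      if i < k - 2 then i + 1 else if i < h then i + 2 else if i = h then k - 1 else i + 1 :=
    ⟨_, rfl⟩
  have hlt : ∀ i < n, p i < n := by
    intro i hi
    simp only [hp]
    split_ifs <;> omega
  have hw' := hw.comp p hlt (by
    intro i hi j hj hij
    simp only [hp] at hij
    split_ifs at hij <;> omega)
  have hmid : p h = k - 1 := by
    simp only [hp]
    split_ifs <;> omega
  have hlast : p (n - 1) = 0 := by simp [hp]
  have hz : ∀ i < n, k - 2 ≤ i → i ≠ h → i ≠ n - 1 → d (p i) = 0 := by
    intro i hi hki hih hin
    refine hzero _ (hlt i hi) ?_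
    simp only [hp]
    split_ifs <;> omega
  have ha : ∀ i j, i < j → j < h → d (p j) ≤ d (p i) := by
    intro i j hij hj
    refine hanti _ _ ?_ (hlt j (by omega))
    simp only [hp]
    split_ifs <;> omega
  have hmin : ∀ i < k - 2, d (k - 1) ≤ d (p i) := by
    intro i hi
    refine hanti _ _ ?_ (by omega)
    simp only [hp]
    split_ifs <;> omega
  have h0 : d (k - 1) ≤ d 0 := hanti _ _ (by omega) (by omega)
  by_cases htwo : 2 ≤ d 0
  · refine hw'.irregularUnion_of_two_le (s := k - 2) h10 hn hn' (by omega) ha hz ?_ ?_ ?_ ?_ <;>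
      simp only [Function.comp_apply, hmid, hlast]
    · exact hpos
    · exact hsmall
    · exact hmin
    · exact htwo
  · refine hw'.irregularUnion_of_eq_one (s := k - 2) h10 hn hn' (by omega) ha hz ?_ ?_ ?_ <;>
      simp only [Function.comp_apply, hmid, hlast]
    · omega
    · intro i hi
      have h1 := hmin i hi
      have h2 := hanti 0 (p i) (by omega) (hlt i (by omega))
      omega
    · omega

theorem SplitLabelling.irregularUnion {V : Type*} [Fintype V] {G : SimpleGraph V}
    {n : ℕ} {w : ℕ → V} {d : ℕ → ℕ} (hw : SplitLabelling G n w d) (h10 : 10 ≤ n)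
    (hanti : ∀ i j, i ≤ j → j < n → d j ≤ d i)
    (hmax : ∀ y, (∀ j < n, y ≠ w j) → ∃ j < n, ¬ G.Adj (w j) y)
    (hd : n / 2 ≤ d 0 ∨ 1 ≤ d 1) : IrregularUnion G := by
  by_cases hmid : 1 ≤ d (n / 2)
  · exact hw.irregularUnion_of_pos_mid (by omega) (by omega) (by omega) hanti hmid fun _ => hmax
  have hex : ∃ k, d k = 0 := ⟨n / 2, by omega⟩
  -- By monotonicity `k` is the number of clique vertices with stable neighbours.
  obtain ⟨k, hk0, hklt⟩ : ∃ k, d k = 0 ∧ ∀ i < k, d i ≠ 0 :=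
    ⟨Nat.find hex, Nat.find_spec hex, fun i hi => Nat.find_min hex hi⟩
  have hkh : k ≤ n / 2 := by
    by_contra hcon
    exact hklt _ (by omega) (by omega : d (n / 2) = 0)
  have hzero : ∀ i < n, k ≤ i → d i = 0 := by
    intro i hi hki
    have := hanti k i hki hi
    omega
  have hk1 : 1 ≤ k := by
    by_contra hcon
    obtain rfl : k = 0 := by omega
    have := hanti 0 1 (by omega) (by omega)
    omega
  have hlast := hklt (k - 1) (by omega)
  by_cases hlarge : n / 2 ≤ d (k - 1) ∨ (2 ≤ k ∧ n / 2 ≤ d (k - 1) + 1)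
  · exact hw.irregularUnion_of_few_large (by omega) (by omega) hanti hk1 hkh hzero hlarge
  · have hk2 : 2 ≤ k := by
      by_contra hcon
      obtain rfl : k = 1 := by omega
      simp only [Nat.sub_self] at hlarge
      omega
    exact hw.irregularUnion_of_few_small h10 (by omega) (by omega) hanti hk2 hkh hzero
      (by omega) (by omega)

/-! ### Three graphs: removing a star -/

/-- The star with centre `w 0` that contains all edges from `w 0` to the stable set and two edges
of the clique. -/
def starGraph {V : Type*} (G : SimpleGraph V) (n : ℕ) (w : ℕ → V) : SimpleGraph V where
  Adj a b := G.Adj a b ∧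
    ((a = w 0 ∧ ((∀ i < n, b ≠ w i) ∨ b = w (n - 1) ∨ b = w (n - 2))) ∨
      (b = w 0 ∧ ((∀ i < n, a ≠ w i) ∨ a = w (n - 1) ∨ a = w (n - 2))))
  symm := ⟨fun _ _ h => ⟨h.1.symm, h.2.symm⟩⟩
  loopless := ⟨fun a h => G.loopless.irrefl a h.1⟩

theorem SplitLabelling.irregular_starGraph {V : Type*} [Fintype V] {G : SimpleGraph V}
    {n : ℕ} {w : ℕ → V} {d : ℕ → ℕ} (hw : SplitLabelling G n w d) (hn : 3 ≤ n) :
    Irregular (starGraph G n w) := by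
  -- The two clique edges make the star locally irregular even if `w 0` has no stable neighbour.
  have hcentre : 2 ≤ deg (starGraph G n w) (w 0) := by
    have hne : w (n - 1) ≠ w (n - 2) := fun h => by
      have := hw.inj _ (by omega) _ (by omega) h
      omega
    rw [deg, ← Set.ncard_pair hne]
    refine Set.ncard_le_ncard ?_ (Set.toFinite _)
    rintro x (rfl | rfl)
    · exact ⟨hw.clique _ (by omega) _ (by omega) (by omega), Or.inl ⟨rfl, Or.inr (Or.inl rfl)⟩⟩
    · exact ⟨hw.clique _ (by omega) _ (by omega) (by omega), Or.inl ⟨rfl, Or.inr (Or.inr rfl)⟩⟩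
  have hleaf : ∀ b, (starGraph G n w).Adj (w 0) b → deg (starGraph G n w) b = 1 := by
    intro b hb
    rw [deg, Set.ncard_eq_one]
    refine ⟨w 0, ?_⟩
    ext x
    rw [Set.mem_singleton_iff, SimpleGraph.mem_neighborSet]
    constructor
    · rintro ⟨_, ⟨rfl, _⟩ | ⟨h, _⟩⟩
      · exact ((starGraph G n w).loopless.irrefl _ hb).elim
      · exact h
    · rintro rfl
      exact hb.symm
  intro u v huv
  obtain ⟨_, ⟨rfl, _⟩ | ⟨rfl, _⟩⟩ := id huv
  · have := hleaf v huv
    omega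
  · have := hleaf u huv.symm
    omega

/-- The centre becomes a stable vertex, adjacent to all but two of the remaining clique vertices,
and the original stable vertices become isolated. As the last value is `0`, the maximality condition
of `irregularUnion_of_pos_mid` is vacuous. -/
theorem SplitLabelling.sdiff_starGraph {V : Type*} [Fintype V] {G : SimpleGraph V}
    {n : ℕ} {w : ℕ → V} {d : ℕ → ℕ} (hw : SplitLabelling G n w d) (hn : 3 ≤ n)
    (hd : ∀ i < n, 1 ≤ i → d i = 0) :
    SplitLabelling (G \ starGraph G n w) (n - 1) (fun i => w (i + 1))
      (fun i => if i + 3 < n then 1 else 0) := by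
  have hne : ∀ i < n - 1, w (i + 1) ≠ w 0 := fun i hi h => by
    have := hw.inj _ (by omega) _ (by omega) h
    omega
  have hout : ∀ y, y ≠ w 0 → (∀ j < n - 1, y ≠ w (j + 1)) → ∀ j < n, y ≠ w j := by
    rintro y hy0 hy (_ | j) hj
    · exact hy0
    · exact hy j (by omega)
  refine ⟨?_, ?_, ?_, ?_⟩
  · intro i hi j hj h
    have := hw.inj _ (by omega) _ (by omega) h
    omega
  · intro i hi j hj hij
    rw [SimpleGraph.sdiff_adj]
    refine ⟨hw.clique _ (by omega) _ (by omega) (by omega), ?_⟩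
    rintro ⟨_, ⟨h, _⟩ | ⟨h, _⟩⟩
    · exact hne i hi h
    · exact hne j hj h
  · intro a b ha hb
    rw [SimpleGraph.sdiff_adj]
    rintro ⟨hG, hS⟩
    by_cases ha0 : a = w 0
    · by_cases hb0 : b = w 0
      · rw [ha0, hb0] at hG
        exact G.loopless.irrefl _ hG
      · exact hS ⟨hG, Or.inl ⟨ha0, Or.inl (hout b hb0 hb)⟩⟩
    · by_cases hb0 : b = w 0
      · exact hS ⟨hG, Or.inr ⟨hb0, Or.inl (hout a ha0 ha)⟩⟩
      · exact hw.stable a b (hout a ha0 ha) (hout b hb0 hb) hG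
  · intro i hi
    have hzero : ∀ y, G.Adj (w (i + 1)) y → (∀ j < n - 1, y ≠ w (j + 1)) → y = w 0 := by
      intro y hadj hy
      by_contra hy0
      have := hw.pos_of_adj (by omega) (hout y hy0 hy) hadj
      have := hd (i + 1) (by omega) (by omega)
      omega
    have hadj0 : G.Adj (w (i + 1)) (w 0) := hw.clique _ (by omega) _ (by omega) (by omega)
    split_ifs with h3
    · rw [Set.ncard_eq_one]
      refine ⟨w 0, ?_⟩
      ext y
      rw [Set.mem_singleton_iff]
      constructor
      · rintro ⟨h, hy⟩
        exact hzero y h.1 hy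
      · rintro rfl
        refine ⟨⟨hadj0, ?_⟩, fun j hj => (hne j hj).symm⟩
        rintro ⟨_, ⟨h, _⟩ | ⟨_, h | h | h⟩⟩
        · exact hne i hi h
        · exact h (i + 1) (by omega) rfl
        · have := hw.inj _ (by omega) _ (by omega) h
          omega
        · have := hw.inj _ (by omega) _ (by omega) h
          omega
    · rw [Set.ncard_eq_zero (Set.toFinite _), Set.eq_empty_iff_forall_notMem]
      rintro y ⟨h, hy⟩
      obtain rfl := hzero y h.1 hy
      refine h.2 ⟨hadj0, Or.inr ⟨rfl, Or.inr ?_⟩⟩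
      have : i + 1 = n - 1 ∨ i + 1 = n - 2 := by omega
      rcases this with h | h
      · exact Or.inl (by rw [h])
      · exact Or.inr (by rw [h])

theorem SplitLabelling.irrChromaticIndex_le_three {V : Type*} [Fintype V] {G : SimpleGraph V}
    {n : ℕ} {w : ℕ → V} {d : ℕ → ℕ} (hw : SplitLabelling G n w d) (hn : 10 ≤ n)
    (hd : ∀ i < n, 1 ≤ i → d i = 0) : irrChromaticIndex G ≤ 3 := by
  obtain ⟨R, S, hcov, hdisj, hR, hS⟩ :=
    (hw.sdiff_starGraph (by omega) hd).irregularUnion_of_pos_mid (h := (n - 1) / 2)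
      (by omega) (by omega) (by omega)
      (fun i j hij hj => by split_ifs <;> omega)
      (by rw [if_pos (by omega)])
      (fun h => by rw [if_neg (by omega)] at h; omega)
  have hR' : ∀ a b, R.Adj a b → ¬ (starGraph G n w).Adj a b := fun a b h =>
    ((hcov a b).2 (Or.inl h)).2
  have hS' : ∀ a b, S.Adj a b → ¬ (starGraph G n w).Adj a b := fun a b h =>
    ((hcov a b).2 (Or.inr h)).2
  refine irrChromaticIndex_le_of_irregular (k := 3) ![R, S, starGraph G n w] ?_ ?_ ?_
  · intro i j hij a b
    have h1 := hdisj a b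
    have h2 := hR' a b
    have h3 := hS' a b
    fin_cases i <;> fin_cases j <;> first | exact (hij rfl).elim | skip
    · exact h1
    · exact h2
    · exact imp_not_comm.1 h1
    · exact h3
    · exact imp_not_comm.1 h2
    · exact imp_not_comm.1 h3
  · intro a b
    have h1 := hcov a b
    rw [SimpleGraph.sdiff_adj] at h1
    have h2 : (starGraph G n w).Adj a b → G.Adj a b := fun h => h.1
    have h3 : (∃ i, (![R, S, starGraph G n w] i).Adj a b) ↔
        R.Adj a b ∨ S.Adj a b ∨ (starGraph G n w).Adj a b := by
      simp [Fin.exists_fin_succ]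
    rw [h3]
    tauto
  · intro i
    fin_cases i
    · exact hR
    · exact hS
    · exact hw.irregular_starGraph (by omega)

/-! ### The lower bound: degree counting -/

theorem two_mul_sum_Ico_id {a b : ℕ} (hab : a ≤ b) :
    2 * ∑ k ∈ Finset.Ico a b, (k : ℤ) = b * (b - 1) - a * (a - 1) := by
  induction b, hab using Nat.le_induction with
  | base => simp
  | succ b hab ih =>
    rw [Finset.sum_Ico_succ_top hab, mul_add, ih]
    push_cast
    ring

theorem sum_Ico_half_sign (n : ℕ) :
    ∑ k ∈ Finset.Ico 1 n, (if n ≤ 2 * k then (k : ℤ) else -k) = ((n / 2 : ℕ) : ℤ) ^ 2 := by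
  rcases Nat.eq_zero_or_pos n with rfl | hn
  · simp
  have h1 : ∑ k ∈ Finset.Ico 1 ((n + 1) / 2), (if n ≤ 2 * k then (k : ℤ) else -k) =
      -∑ k ∈ Finset.Ico 1 ((n + 1) / 2), (k : ℤ) := by
    rw [← Finset.sum_neg_distrib]
    refine Finset.sum_congr rfl fun k hk => ?_
    rw [Finset.mem_Ico] at hk
    rw [if_neg (by omega)]
  have h2 : ∑ k ∈ Finset.Ico ((n + 1) / 2) n, (if n ≤ 2 * k then (k : ℤ) else -k) =
      ∑ k ∈ Finset.Ico ((n + 1) / 2) n, (k : ℤ) := by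
    refine Finset.sum_congr rfl fun k hk => ?_
    rw [Finset.mem_Ico] at hk
    rw [if_pos (by omega)]
  rw [← Finset.sum_Ico_consecutive _ (by omega : 1 ≤ (n + 1) / 2) (by omega), h1, h2]
  have h3 := two_mul_sum_Ico_id (by omega : 1 ≤ (n + 1) / 2)
  have h4 := two_mul_sum_Ico_id (by omega : (n + 1) / 2 ≤ n)
  rcases Nat.even_or_odd' n with ⟨h, rfl | rfl⟩
  · rw [show (2 * h + 1) / 2 = h by omega] at *
    rw [show 2 * h / 2 = h by omega]
    push_cast at *
    linarith
  · rw [show (2 * h + 1 + 1) / 2 = h + 1 by omega] at *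
    rw [show (2 * h + 1) / 2 = h by omega]
    push_cast at *
    linarith

theorem sum_Ico_half_indicator (n : ℕ) :
    ∑ k ∈ Finset.Ico 1 n, (if n ≤ 2 * k then (1 : ℤ) else 0) = ((n / 2 : ℕ) : ℤ) := by
  rw [Finset.sum_boole]
  have : (Finset.Ico 1 n).filter (fun k => n ≤ 2 * k) =
      (Finset.Ico 1 n).filter fun k => (n + 1) / 2 ≤ k := by
    ext k
    simp only [Finset.mem_filter, Finset.mem_Ico]
    omega
  rw [this, Finset.Ico_filter_le, Nat.card_Ico]
  congr 1
  omega

/-- In a graph on `0, …, n - 1` in which the degrees of `1, …, n - 1` are distinct and positive,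
the vertex `0` is adjacent precisely to the vertices of degree at least `n / 2`. -/
theorem adj_zero_iff_of_rdeg_injective {n : ℕ} (hn : 1 ≤ n) {c : ℕ → ℕ → Prop}
    (hsymm : ∀ i j, c i j → c j i)
    (hinj : ∀ i j, 1 ≤ i → i < n → 1 ≤ j → j < n → rdeg n c i = rdeg n c j → i = j)
    (hpos : ∀ i, 1 ≤ i → i < n → 1 ≤ rdeg n c i) :
    (∀ k, 1 ≤ k → k < n → ∃ i, 1 ≤ i ∧ i < n ∧ rdeg n c i = k) ∧
    (∀ i, 1 ≤ i → i < n → (c i 0 ↔ n ≤ 2 * rdeg n c i)) ∧ rdeg n c 0 = n / 2 := by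
  classical
  set I := Finset.Ico 1 n with hI
  have hrlt : ∀ i < n, rdeg n c i < n := by
    intro i hi
    have := rdeg_add_rdeg_not c hi
    omega
  have hinjOn : Set.InjOn (rdeg n c) I := by
    intro i hi j hj h
    simp only [hI, Finset.coe_Ico, Set.mem_Ico] at hi hj
    exact hinj i j hi.1 hi.2 hj.1 hj.2 h
  have himage : I.image (rdeg n c) = I := by
    refine Finset.eq_of_subset_of_card_le ?_ ?_
    · intro k hk
      obtain ⟨i, hi, rfl⟩ := Finset.mem_image.1 hk
      rw [hI, Finset.mem_Ico] at hi ⊢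
      exact ⟨hpos i hi.1 hi.2, hrlt i hi.2⟩
    · rw [Finset.card_image_of_injOn hinjOn]
  let A : ℕ → ℕ → ℤ := fun i j => if i ≠ j ∧ c i j then 1 else 0
  let u : ℕ → ℤ := fun i => if n ≤ 2 * rdeg n c i then 1 else 0
  have hA01 : ∀ i j, A i j = 0 ∨ A i j = 1 := by
    intro i j
    simp only [A]
    split_ifs <;> simp
  have hu01 : ∀ i, u i = 0 ∨ u i = 1 := by
    intro i
    simp only [u]
    split_ifs <;> simp
  have hAsymm : ∀ i j, A i j = A j i := by
    intro i j
    simp only [A]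
    have : (i ≠ j ∧ c i j) ↔ (j ≠ i ∧ c j i) :=
      ⟨fun h => ⟨h.1.symm, hsymm _ _ h.2⟩, fun h => ⟨h.1.symm, hsymm _ _ h.2⟩⟩
    simp only [this]
  have hAdiag : ∀ i, A i i = 0 := fun i => by simp [A]
  have hrow : ∀ i, (rdeg n c i : ℤ) = A i 0 + ∑ j ∈ I, A i j := by
    intro i
    have h1 : (rdeg n c i : ℤ) = ∑ j ∈ Finset.range n, A i j := by
      rw [Finset.sum_boole, rdeg]
    rw [h1, Finset.range_eq_Ico, ← Finset.sum_Ico_consecutive _ (by omega : 0 ≤ 1) hn, ← hI]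
    simp
  have hsumu : ∑ i ∈ I, u i = ((n / 2 : ℕ) : ℤ) := by
    rw [← sum_Ico_half_indicator n, ← hI]
    conv_rhs => rw [← himage]
    rw [Finset.sum_image hinjOn]
  have hsumr : ∑ i ∈ I, (2 * u i - 1) * (rdeg n c i : ℤ) = ((n / 2 : ℕ) : ℤ) ^ 2 := by
    rw [← sum_Ico_half_sign n, ← hI]
    conv_rhs => rw [← himage]
    rw [Finset.sum_image hinjOn]
    refine Finset.sum_congr rfl fun i _ => ?_
    simp only [u]
    split_ifs <;> ring
  -- Let U be the set of vertices with `u i = 1`, of size m = ⌊n/2⌋. The degree sum over U minus the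
  -- one over its complement in `I` is m². Split off the contribution of the edges at `0` from that
  -- of the edges inside `I`.
  have hexpand : ∑ i ∈ I, (2 * u i - 1) * (rdeg n c i : ℤ) =
      ∑ i ∈ I, (2 * u i - 1) * A i 0 + ∑ i ∈ I, ∑ j ∈ I, (2 * u i - 1) * A i j := by
    rw [← Finset.sum_add_distrib]
    refine Finset.sum_congr rfl fun i _ => ?_
    rw [hrow i, mul_add, Finset.mul_sum]
  have hswap : ∑ i ∈ I, ∑ j ∈ I, (2 * u i - 1) * A i j =
      ∑ i ∈ I, ∑ j ∈ I, (2 * u j - 1) * A i j := by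
    rw [Finset.sum_comm]
    refine Finset.sum_congr rfl fun i _ => Finset.sum_congr rfl fun j _ => ?_
    rw [hAsymm]
  -- After symmetrising, the edges inside `I` contribute twice (edges in U minus edges in the
  -- complement), at most m(m - 1). So the edges at `0` contribute at least m; this is also their
  -- maximum, and equality fixes each of them.
  have hbound : ∑ i ∈ I, ∑ j ∈ I, (u i + u j - 1) * A i j ≤
      ∑ i ∈ I, ∑ j ∈ I, (u i * u j - if i = j then u i else 0) := by
    refine Finset.sum_le_sum fun i _ => Finset.sum_le_sum fun j _ => ?_
    by_cases hij : i = j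
    · subst hij
      rw [hAdiag]
      rcases hu01 i with h | h <;> simp [h]
    · rcases hu01 i with h | h <;> rcases hu01 j with h' | h' <;>
        rcases hA01 i j with h'' | h'' <;> simp [h, h', h'', hij]
  have hright : ∑ i ∈ I, ∑ j ∈ I, (u i * u j - if i = j then u i else 0) =
      ((n / 2 : ℕ) : ℤ) ^ 2 - ((n / 2 : ℕ) : ℤ) := by
    simp_rw [Finset.sum_sub_distrib]
    rw [← Finset.sum_mul_sum, hsumu]
    simp only [Finset.sum_ite_eq]
    rw [Finset.sum_congr rfl (fun i hi => if_pos hi), hsumu]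
    ring
  have hleft : ∑ i ∈ I, ∑ j ∈ I, (u i + u j - 1) * A i j =
      ∑ i ∈ I, ∑ j ∈ I, (2 * u i - 1) * A i j := by
    have : 2 * ∑ i ∈ I, ∑ j ∈ I, (u i + u j - 1) * A i j =
        ∑ i ∈ I, ∑ j ∈ I, (2 * u i - 1) * A i j + ∑ i ∈ I, ∑ j ∈ I, (2 * u j - 1) * A i j := by
      simp_rw [Finset.mul_sum, ← Finset.sum_add_distrib]
      refine Finset.sum_congr rfl fun i _ => Finset.sum_congr rfl fun j _ => ?_
      ring
    rw [← hswap] at this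
    linarith
  have hpt : ∀ i ∈ I, (2 * u i - 1) * A i 0 ≤ u i := by
    intro i _
    rcases hu01 i with h | h <;> rcases hA01 i 0 with h' | h' <;> simp [h, h']
  have htot : ∑ i ∈ I, (2 * u i - 1) * A i 0 = ∑ i ∈ I, u i := by
    refine le_antisymm (Finset.sum_le_sum hpt) ?_
    rw [hsumu]
    linarith
  have hAu : ∀ i ∈ I, A i 0 = u i := by
    intro i hi
    have := (Finset.sum_eq_sum_iff_of_le hpt).1 htot i hi
    rcases hu01 i with h | h <;> rw [h] at this ⊢ <;> linarith
  refine ⟨?_, ?_, ?_⟩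
  · intro k hk hk'
    have : k ∈ I.image (rdeg n c) := by
      rw [himage, hI, Finset.mem_Ico]
      exact ⟨hk, hk'⟩
    obtain ⟨i, hi, h⟩ := Finset.mem_image.1 this
    rw [hI, Finset.mem_Ico] at hi
    exact ⟨i, hi.1, hi.2, h⟩
  · intro i hi hi'
    have h1 := hAu i (by rw [hI, Finset.mem_Ico]; exact ⟨hi, hi'⟩)
    have h0 : i ≠ 0 := by omega
    simp only [A, u, ne_eq, h0, not_false_eq_true, true_and] at h1
    by_cases h2 : c i 0 <;> by_cases h3 : n ≤ 2 * rdeg n c i <;> simp [h2, h3] at h1 ⊢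
  · have h1 := hrow 0
    rw [hAdiag, Finset.sum_congr rfl (fun j hj => (hAsymm 0 j).trans (hAu j hj)), hsumu,
      zero_add] at h1
    exact_mod_cast h1

/-- The number of neighbours of `w i` in `H` outside `w 0, …, w (n - 1)`. -/
noncomputable def outDeg {V : Type*} (H : SimpleGraph V) (n : ℕ) (w : ℕ → V) (i : ℕ) : ℕ :=
  {y | H.Adj (w i) y ∧ ∀ j < n, y ≠ w j}.ncard

/-- Two vertices other than `w 0` with equal red clique degree also have equal blue degree, and
their edge would be bad in its colour. So these degrees are distinct and the adjacencies of `w 0`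
are forced. -/
theorem half_le_of_rdeg_pos {V : Type*} [Fintype V] {n : ℕ} {w : ℕ → V} (hn : 3 ≤ n)
    {R S : SimpleGraph V} (hwinj : ∀ i < n, ∀ j < n, w i = w j → i = j)
    (hadj : ∀ i < n, ∀ j < n, i ≠ j → (S.Adj (w i) (w j) ↔ ¬ R.Adj (w i) (w j)))
    (hR : Irregular R) (hS : Irregular S)
    (hoR : ∀ i, 1 ≤ i → i < n → outDeg R n w i = 0)
    (hoS : ∀ i, 1 ≤ i → i < n → outDeg S n w i = 0)
    (hpos : ∀ i, 1 ≤ i → i < n → 1 ≤ rdeg n (fun a b => R.Adj (w a) (w b)) i) :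
    n / 2 ≤ outDeg R n w 0 + outDeg S n w 0 := by
  set c : ℕ → ℕ → Prop := fun a b => R.Adj (w a) (w b) with hc
  have hdR : ∀ i, deg R (w i) = rdeg n c i + outDeg R n w i := deg_eq_rdeg_add hwinj R
  have hdS : ∀ i < n, deg S (w i) = n - 1 - rdeg n c i + outDeg S n w i := by
    intro i hi
    have h1 : deg S (w i) = _ := deg_eq_rdeg_add hwinj S i
    have h2 : rdeg n (fun a b => S.Adj (w a) (w b)) i = rdeg n (fun a b => ¬ c a b) i :=
      rdeg_congr fun j hj hij => hadj i hi j hj hij.symm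
    have h3 := rdeg_add_rdeg_not c hi
    rw [h1, h2, outDeg]
    omega
  have hinj : ∀ i j, 1 ≤ i → i < n → 1 ≤ j → j < n → rdeg n c i = rdeg n c j → i = j := by
    intro i j hi hi' hj hj' h
    by_contra hij
    by_cases hRij : R.Adj (w i) (w j)
    · refine hR hRij ?_
      rw [hdR, hdR, hoR i hi hi', hoR j hj hj', h]
    · refine hS ((hadj i hi' j hj' hij).2 hRij) ?_
      rw [hdS i hi', hdS j hj', hoS i hi hi', hoS j hj hj', h]
  obtain ⟨hsurj, hzero, hdeg⟩ :=
    adj_zero_iff_of_rdeg_injective (by omega) (fun i j h => R.symm.symm _ _ h) hinj hpos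
  have hred : ∀ k, 1 ≤ k → k < n → n ≤ 2 * k → n / 2 + outDeg R n w 0 ≠ k := by
    intro k hk hk' hnk h
    obtain ⟨i, hi, hi', rfl⟩ := hsurj k hk hk'
    refine hR ((hzero i hi hi').2 hnk) ?_
    rw [hdR, hdR, hoR i hi hi', hdeg, h]
    rfl
  have hblue : ∀ k, 1 ≤ k → k < n → 2 * k < n →
      n - 1 - n / 2 + outDeg S n w 0 ≠ n - 1 - k := by
    intro k hk hk' hnk h
    obtain ⟨i, hi, hi', rfl⟩ := hsurj k hk hk'
    have hnot : ¬ R.Adj (w i) (w 0) := fun h' => by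
      have := (hzero i hi hi').1 h'
      omega
    refine hS ((hadj i hi' 0 (by omega) (by omega)).2 hnot) ?_
    rw [hdS i hi', hdS 0 (by omega), hoS i hi hi', hdeg, h]
    rfl
  by_contra hlt
  -- For even `n` the red constraint forces `n / 2 ≤ outDeg R n w 0`; for odd `n` the blue one
  -- forces `n / 2 ≤ outDeg S n w 0`.
  have h1 := hred (n / 2 + outDeg R n w 0)
  have h2 := hblue (n / 2 - outDeg S n w 0)
  omega

theorem SplitLabelling.half_le_of_irregularUnion {V : Type*} [Fintype V] {G : SimpleGraph V}
    {n : ℕ} {w : ℕ → V} {d : ℕ → ℕ} (hw : SplitLabelling G n w d) (hn : 3 ≤ n)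
    (hd : ∀ i < n, 1 ≤ i → d i = 0) (hG : IrregularUnion G) : n / 2 ≤ d 0 := by
  obtain ⟨R, S, hcov, hdisj, hR, hS⟩ := hG
  have hout : ∀ i < n, outDeg R n w i + outDeg S n w i = d i := by
    intro i hi
    rw [← hw.leaves i hi, outDeg, outDeg,
      ← Set.ncard_union_eq ?_ (Set.toFinite _) (Set.toFinite _)]
    · congr 1
      ext y
      have := hcov (w i) y
      simp only [Set.mem_union, Set.mem_ofPred_eq]
      tauto
    · rw [Set.disjoint_left]
      rintro y ⟨h, _⟩ ⟨h', _⟩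
      exact hdisj _ _ h h'
  have hadj : ∀ i < n, ∀ j < n, i ≠ j → (S.Adj (w i) (w j) ↔ ¬ R.Adj (w i) (w j)) := by
    intro i hi j hj hij
    have h1 := (hcov (w i) (w j)).1 (hw.clique i hi j hj hij)
    have h2 := hdisj (w i) (w j)
    tauto
  have hadj' : ∀ i < n, ∀ j < n, i ≠ j → (R.Adj (w i) (w j) ↔ ¬ S.Adj (w i) (w j)) := by
    intro i hi j hj hij
    rw [hadj i hi j hj hij, not_not]
  have hoR : ∀ i, 1 ≤ i → i < n → outDeg R n w i = 0 := by
    intro i hi hi'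
    have := hout i hi'
    have := hd i hi' hi
    omega
  have hoS : ∀ i, 1 ≤ i → i < n → outDeg S n w i = 0 := by
    intro i hi hi'
    have := hout i hi'
    have := hd i hi' hi
    omega
  rw [← hout 0 (by omega)]
  have hcompl : ∀ i < n, rdeg n (fun a b => R.Adj (w a) (w b)) i +
      rdeg n (fun a b => S.Adj (w a) (w b)) i = n - 1 := by
    intro i hi
    rw [← rdeg_add_rdeg_not (fun a b => R.Adj (w a) (w b)) hi]
    congr 1
    exact rdeg_congr fun j hj hij => hadj i hi j hj hij.symm
  have hadj_of_rdeg : ∀ (H K : SimpleGraph V), ∀ i < n, ∀ j < n, i ≠ j →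
      (K.Adj (w i) (w j) ↔ ¬ H.Adj (w i) (w j)) →
      rdeg n (fun a b => K.Adj (w a) (w b)) i = 0 → H.Adj (w i) (w j) := by
    classical
    intro H K i hi j hj hij hK h0
    by_contra h
    rw [rdeg, Finset.card_eq_zero] at h0
    have : j ∈ (∅ : Finset ℕ) := by
      rw [← h0, Finset.mem_filter, Finset.mem_range]
      exact ⟨hj, hij, hK.2 h⟩
    simp at this
  -- A vertex without red clique edges and one without blue clique edges cannot coexist, as the edge
  -- between them has a colour. So the degrees are positive in one of the colours.
  by_cases hpos : ∀ i, 1 ≤ i → i < n → 1 ≤ rdeg n (fun a b => R.Adj (w a) (w b)) i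
  · exact half_le_of_rdeg_pos hn hw.inj hadj hR hS hoR hoS hpos
  · rw [add_comm]
    refine half_le_of_rdeg_pos hn hw.inj hadj' hS hR hoS hoR ?_
    intro j hj hj'
    by_contra hj0
    push Not at hpos
    obtain ⟨i, hi, hi', hi0⟩ := hpos
    have hij : i ≠ j := by
      rintro rfl
      have := hcompl i hi'
      omega
    have h1 := hadj_of_rdeg S R i hi' j hj' hij (hadj' i hi' j hj' hij) (by omega)
    have h2 := hadj_of_rdeg R S j hj' i hi' hij.symm (hadj j hj' i hi' hij.symm) (by omega)
    exact hdisj _ _ h2.symm h1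

/-! ### From split graphs to labellings, and the theorem -/

theorem IsSplit.splitLabelling {V : Type*} {G : SimpleGraph V} {X Y : Set V}
    (hG : IsSplit G X Y) {n : ℕ} {w : ℕ → V} {d : ℕ → ℕ}
    (hinj : ∀ i < n, ∀ j < n, w i = w j → i = j) (hX : ∀ x, x ∈ X ↔ ∃ i < n, w i = x)
    (hd : ∀ i < n, d i = degIn G (w i) Y) : SplitLabelling G n w d := by
  have hY : ∀ y, y ∈ Y ↔ ∀ i < n, y ≠ w i := by
    intro y
    rw [hG.compl, Set.mem_compl_iff, hX]
    push Not
    exact forall₂_congr fun i _ => ne_comm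
  refine ⟨hinj, ?_, ?_, ?_⟩
  · intro i hi j hj hij
    exact hG.maximal_clique.1 ((hX _).2 ⟨i, hi, rfl⟩) ((hX _).2 ⟨j, hj, rfl⟩)
      fun h => hij (hinj i hi j hj h)
  · intro a b ha hb hab
    exact hG.stable ((hY a).2 ha) ((hY b).2 hb) hab.ne hab
  · intro i hi
    rw [hd i hi, degIn]
    congr 1
    ext y
    rw [Set.mem_inter_iff, hY]
    rfl

theorem IsSplit.exists_not_adj {V : Type*} {G : SimpleGraph V} {X Y : Set V}
    (hG : IsSplit G X Y) {y : V} (hy : y ∉ X) : ∃ x ∈ X, ¬ G.Adj x y := by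
  by_contra hcon
  push Not at hcon
  have hcl : G.IsClique (insert y X) :=
    hG.maximal_clique.1.insert fun b hb _ => (hcon b hb).symm
  exact hy (hG.maximal_clique.2 hcl (Set.subset_insert y X) (Set.mem_insert y X))

end SplitIrr

theorem theorem1 {V : Type*} [Fintype V] (G : SimpleGraph V) (X Y : Set V)
    (hG : SplitIrr.IsSplit G X Y) (n : ℕ) (hn : 10 ≤ n)
    (v : Fin n → V) (hv : Function.Injective v) (hX : Set.range v = X)
    (d : Fin n → ℕ) (hd : ∀ i, d i = SplitIrr.degIn G (v i) Y) (hanti : Antitone d) :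
    (SplitIrr.irrChromaticIndex G ≤ 2 ↔ n / 2 ≤ d ⟨0, by omega⟩ ∨ 1 ≤ d ⟨1, by omega⟩) ∧
    (SplitIrr.irrChromaticIndex G = 3 ↔ d ⟨0, by omega⟩ < n / 2 ∧ d ⟨1, by omega⟩ = 0) ∧
    SplitIrr.irrChromaticIndex G ≤ 3 := by
  obtain ⟨w, hw⟩ : ∃ w : ℕ → V, ∀ i (hi : i < n), w i = v ⟨i, hi⟩ :=
    -- The values from `n` on are irrelevant, since a labelling only constrains indices below `n`.
    ⟨fun i => if hi : i < n then v ⟨i, hi⟩ else v ⟨0, by omega⟩, fun i hi => dif_pos hi⟩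
  obtain ⟨D, hD⟩ : ∃ D : ℕ → ℕ, ∀ i (hi : i < n), D i = d ⟨i, hi⟩ :=
    ⟨fun i => if hi : i < n then d ⟨i, hi⟩ else 0, fun i hi => dif_pos hi⟩
  have hinj : ∀ i < n, ∀ j < n, w i = w j → i = j := by
    intro i hi j hj h
    rw [hw i hi, hw j hj] at h
    exact Fin.mk.inj_iff.1 (hv h)
  have hXw : ∀ x, x ∈ X ↔ ∃ i < n, w i = x := by
    intro x
    rw [← hX, Set.mem_range]
    constructor
    · rintro ⟨i, rfl⟩
      exact ⟨i, i.2, hw i i.2⟩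
    · rintro ⟨i, hi, rfl⟩
      exact ⟨⟨i, hi⟩, (hw i hi).symm⟩
  have hlab : SplitIrr.SplitLabelling G n w D :=
    hG.splitLabelling hinj hXw fun i hi => by rw [hD i hi, hw i hi, hd]
  have hDanti : ∀ i j, i ≤ j → j < n → D j ≤ D i := by
    intro i j hij hj
    rw [hD i (by omega), hD j hj]
    exact hanti hij
  have hmax : ∀ y, (∀ j < n, y ≠ w j) → ∃ j < n, ¬ G.Adj (w j) y := by
    intro y hy
    have hyX : y ∉ X := fun h => by
      obtain ⟨i, hi, h⟩ := (hXw y).1 h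
      exact hy i hi h.symm
    obtain ⟨x, hx, hadj⟩ := hG.exists_not_adj hyX
    obtain ⟨i, hi, rfl⟩ := (hXw x).1 hx
    exact ⟨i, hi, hadj⟩
  rw [← hD 0 (by omega), ← hD 1 (by omega)]
  have htwo : SplitIrr.irrChromaticIndex G ≤ 2 ↔ n / 2 ≤ D 0 ∨ 1 ≤ D 1 := by
    constructor
    · intro h
      by_contra hcon
      have hzero : ∀ i < n, 1 ≤ i → D i = 0 := by
        intro i hi hi'
        have := hDanti 1 i hi' hi
        omega
      have := hlab.half_le_of_irregularUnion (by omega) hzero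
        (SplitIrr.irregularUnion_of_irrChromaticIndex_le_two h)
      omega
    · intro h
      exact (hlab.irregularUnion hn hDanti hmax h).irrChromaticIndex_le_two
  have hthree : SplitIrr.irrChromaticIndex G ≤ 3 := by
    by_cases h : n / 2 ≤ D 0 ∨ 1 ≤ D 1
    · exact (htwo.2 h).trans (by decide)
    · refine hlab.irrChromaticIndex_le_three hn fun i hi hi' => ?_
      have := hDanti 1 i hi' hi
      omega
  refine ⟨htwo, ?_, hthree⟩
  have hiff : SplitIrr.irrChromaticIndex G = 3 ↔ ¬ SplitIrr.irrChromaticIndex G ≤ 2 := by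
    constructor
    · intro h
      rw [h]
      decide
    · intro h
      refine le_antisymm hthree ?_
      have := Order.add_one_le_of_lt (not_le.1 h)
      exact this
  rw [hiff, htwo]
  omega
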